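/- Let $Q$ be a finite-dimensional quantum system with a density matrix $\gamma$, and let $\{M_x\}_{x\in X}$ be a POVM with finite outcome set $X$ ($M_x\ge 0$, $\sum_x M_x=\mathbb 1$) such that $p(x):=\operatorname{Tr}\{\gamma M_x\}>0$ for all $x\in X$. Let $$\gamma_{XQ}:=\sum_{x}|x\rangle\langle x|\otimes\sqrt{\gamma}\,M_x\sqrt{\gamma},\qquad \gamma_X:=\operatorname{Tr}_Q\gamma_{XQ}.$$ Let $\tau$ be a probability distribution on $X$, put $\sigma_X:=\sum_x\tau(x)|x\rangle\langle x|$, and let $\mathcal S_\tau$ be the set of all states $\sigma_{XQ}=\sum_x\tau(x)|x\rangle\langle x|\otimes\sigma_x$ with density matrices $\sigma_x$ on $Q$ (so $\operatorname{Tr}_Q\sigma_{XQ}=\sigma_X$). Let $\mathbb D(A\|B)$ be any one of the following divergences: 1. Umegaki: $\operatorname{Tr}\{A(\log_2A-\log_2B)\}$; 2. Petz–Rényi: $\frac1{\alpha-1}\log_2\operatorname{Tr}\{A^\alpha B^{1-\alpha}\}$, $\alpha\in(0,1)\cup(1,2]$; 3. sandwiched Rényi: $\frac1{\alpha-1}\log_2\operatorname{Tr}\{(B^{\frac{1-\alpha}{2\alpha}}AB^{\frac{1-\alpha}{2\alpha}})^\alpha\}$,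 $\alpha\in[1/2,1)\cup(1,\infty)$; 4. geometric Rényi: $\frac1{\alpha-1}\log_2\operatorname{Tr}\{B(B^{-1/2}AB^{-1/2})^\alpha\}$, $\alpha\in(0,1)\cup(1,2]$; 5. Belavkin–Staszewski: $\operatorname{Tr}\{A\log_2(A^{1/2}B^{-1}A^{1/2})\}$. For $B>0$ these formulas apply as written. For singular $B\ge 0$ the usual extensions with values in $(-\infty,+\infty]$ are used. Negative powers and logarithms are taken on the support. If $\operatorname{supp}A\not\subseteq\operatorname{supp}B$, the value is $+\infty$ in 1, in 5, and in 2–4 with $\alpha>1$. For $\alpha<1$ the value is $+\infty$ when the trace vanishes. In 4 with $\alpha<1$ and $\operatorname{supp}A\not\subseteq\operatorname{supp}B$, $A$ is replaced by its generalized Schur complement $A_{00}-A_{01}A_{11}^{-1}A_{10}$ on $\operatorname{supp}B$, where the index $0$ refers to $\operatorname{supp}B$, the index $1$ to $\ker B$, and $A_{11}^{-1}$ is the generalized inverse. (In every case this is the limit of the formula along $B+\varepsilon\mathbb 1$, $\varepsilon\downarrow0$.) Then, for each of these divergences, $$\min_{\sigma_{XQ}\in\mathcal S_\tau}\mathbb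 D(\sigma_{XQ}\|\gamma_{XQ})=\mathbb D(\sigma_X\|\gamma_X)=\mathbb D(\tau\|p),$$ where $\mathbb D(\tau\|p)$ is the classical divergence, namely $\sum_x\tau(x)\log_2\frac{\tau(x)}{p(x)}$ in cases 1 and 5, and $\frac1{\alpha-1}\log_2\sum_x\tau(x)^\alpha p(x)^{1-\alpha}$ in cases 2–4. The minimum is attained at exactly one state of $\mathcal S_\tau$, which is the same for all these divergences: $$\hat\gamma_{XQ}=\sum_x\tau(x)|x\rangle\langle x|\otimes\frac{\sqrt\gamma\,M_x\sqrt\gamma}{\operatorname{Tr}\{M_x\gamma\}}.$$ The states $\sqrt\gamma\,M_x\sqrt\gamma/\operatorname{Tr}\{M_x\gamma\}$ form the quantum Bayesian inverse. -/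

import Mathlib

open Matrix
open scoped Kronecker MatrixOrder ComplexOrder

noncomputable section

namespace Retrodiction

variable {n : Type*} [Fintype n] [DecidableEq n]

/-- A density matrix: positive semidefinite with unit trace. -/
def IsDensity (A : Matrix n n ℂ) : Prop := A.PosSemidef ∧ A.trace = 1

/-- The base-two logarithm of a Hermitian matrix, by functional calculus
(with value `0` on the kernel, so that `A * log2 A` obeys `0 log 0 = 0`). -/
def log2 (A : Matrix n n ℂ) : Matrix n n ℂ := cfc (Real.logb 2) A

/-- The support of `A` is contained in the support of `B`, that is, `ker B ⊆ ker A`.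
It holds for every `A` when `B` is positive definite. -/
def SuppLE (A B : Matrix n n ℂ) : Prop := ∀ v : n → ℂ, B *ᵥ v = 0 → A *ᵥ v = 0

/-!
Real powers `A ^ s` of positive semidefinite matrices are those of the continuous functional
calculus (`CFC.rpow`). As `0 ^ s = 0` for real `s ≠ 0`, a power with a negative exponent is taken
on the support (generalized inverse); it is the usual power when the matrix is positive definite.

The divergences below take values in the extended reals. When `B` is positive definite (and `A` is
a density matrix) each is the usual real-valued formula; for singular `B` they carry the
usual conventions, which agree with the limit of the formula along `B + ε 1` as `ε ↓ 0`.
-/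

/-- `(α - 1)⁻¹ log₂ q`, with value `+∞` at `q = 0`. For density matrices, the trace
quantities `q` below vanish only when `α < 1`, where `+∞` is the limiting value. -/
def renyiValue (α q : ℝ) : EReal :=
  if q = 0 then ⊤ else (((1 / (α - 1)) * Real.logb 2 q : ℝ) : EReal)

open Classical in
/-- Umegaki relative entropy `Tr {A (log₂ A - log₂ B)}`. -/
def umegaki (A B : Matrix n n ℂ) : EReal :=
  if SuppLE A B then (((A * (log2 A - log2 B)).trace.re : ℝ) : EReal) else ⊤

open Classical in
/-- Petz–Rényi relative entropy `(α - 1)⁻¹ log₂ Tr {A ^ α B ^ (1 - α)}`. -/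
def petzRenyi (α : ℝ) (A B : Matrix n n ℂ) : EReal :=
  if α < 1 ∨ SuppLE A B then renyiValue α (A ^ α * B ^ (1 - α)).trace.re else ⊤

open Classical in
/-- Sandwiched Rényi relative entropy
`(α - 1)⁻¹ log₂ Tr {(B ^ ((1 - α) / (2 α)) A B ^ ((1 - α) / (2 α))) ^ α}`. -/
def sandwichedRenyi (α : ℝ) (A B : Matrix n n ℂ) : EReal :=
  if α < 1 ∨ SuppLE A B then
    renyiValue α
      ((B ^ ((1 - α) / (2 * α)) * A * B ^ ((1 - α) / (2 * α))) ^ α).trace.re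
  else ⊤

/-- The trace quantity `Tr {B (B ^ (-1/2) A B ^ (-1/2)) ^ α}`. -/
def geometricTrace (α : ℝ) (A B : Matrix n n ℂ) : ℝ :=
  (B * (B ^ (-1 / 2 : ℝ) * A * B ^ (-1 / 2 : ℝ)) ^ α).trace.re

/-- The orthogonal projection onto the kernel of a Hermitian matrix `B`. -/
def kerProj (B : Matrix n n ℂ) : Matrix n n ℂ := cfc (fun t : ℝ => if t = 0 then 1 else 0) B

/-- The generalized Schur complement `A₀₀ - A₀₁ A₁₁⁻¹ A₁₀` of `A` on the support of `B`, the blocks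
being taken with respect to the support of `B` (index 0) and its kernel (index 1). -/
def schurPart (A B : Matrix n n ℂ) : Matrix n n ℂ :=
  (1 - kerProj B) * A * (1 - kerProj B) -
    (1 - kerProj B) * A * kerProj B * (kerProj B * A * kerProj B) ^ (-1 : ℝ) *
      (kerProj B * A * (1 - kerProj B))

open Classical in
/-- Geometric Rényi relative entropy `(α - 1)⁻¹ log₂ Tr {B (B ^ (-1/2) A B ^ (-1/2)) ^ α}`.
If the support of `A` is not contained in that of `B`, the limit along `B + ε 1` is `+∞`
for `α > 1`, while for `α < 1` it is the same formula with `A` replaced by its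
Schur complement on the support of `B`. -/
def geometricRenyi (α : ℝ) (A B : Matrix n n ℂ) : EReal :=
  if SuppLE A B then renyiValue α (geometricTrace α A B)
  else if α < 1 then renyiValue α (geometricTrace α (schurPart A B) B)
  else ⊤

open Classical in
/-- Belavkin–Staszewski relative entropy `Tr {A log₂ (A ^ (1/2) B⁻¹ A ^ (1/2))}`. -/
def belavkinStaszewski (A B : Matrix n n ℂ) : EReal :=
  if SuppLE A B then
    (((A * log2 (A ^ (1 / 2 : ℝ) * B ^ (-1 : ℝ) * A ^ (1 / 2 : ℝ))).trace.re : ℝ) : EReal)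
  else ⊤

/-- The five families of divergences, the Rényi families carrying their order `α`. -/
inductive Divergence : Type
  | umegaki : Divergence
  | petz (α : ℝ) : Divergence
  | sandwiched (α : ℝ) : Divergence
  | geometric (α : ℝ) : Divergence
  | belavkinStaszewski : Divergence

/-- The admissible range of the order `α` in each family. -/
def Divergence.Admissible : Divergence → Prop
  | .umegaki => True
  | .petz α => α ∈ Set.Ioo (0 : ℝ) 1 ∪ Set.Ioc (1 : ℝ) 2
  | .sandwiched α => α ∈ Set.Ico (1 / 2 : ℝ) 1 ∪ Set.Ioi (1 : ℝ)
  | .geometric α => α ∈ Set.Ioo (0 : ℝ) 1 ∪ Set.Ioc (1 : ℝ) 2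
  | .belavkinStaszewski => True

/-- The value `𝔻(A‖B)`. -/
def Divergence.eval (𝔻 : Divergence) (A B : Matrix n n ℂ) : EReal :=
  match 𝔻 with
  | .umegaki => Retrodiction.umegaki A B
  | .petz α => petzRenyi α A B
  | .sandwiched α => sandwichedRenyi α A B
  | .geometric α => geometricRenyi α A B
  | .belavkinStaszewski => Retrodiction.belavkinStaszewski A B

section Classical

variable {X : Type*} [Fintype X]

/-- Kullback–Leibler divergence in bits, for a strictly positive second argument. -/
def classicalKL (τ p : X → ℝ) : ℝ := ∑ x, τ x * Real.logb 2 (τ x / p x)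

/-- Classical Rényi divergence in bits, for a strictly positive second argument. -/
def classicalRenyi (α : ℝ) (τ p : X → ℝ) : ℝ :=
  (1 / (α - 1)) * Real.logb 2 (∑ x, τ x ^ α * p x ^ (1 - α))

/-- The classical divergence to which each quantum divergence reduces. -/
def Divergence.classical (𝔻 : Divergence) (τ p : X → ℝ) : ℝ :=
  match 𝔻 with
  | .umegaki => classicalKL τ p
  | .petz α => classicalRenyi α τ p
  | .sandwiched α => classicalRenyi α τ p
  | .geometric α => classicalRenyi α τ p
  | .belavkinStaszewski => classicalKL τ p

end Classical

section Measurement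

variable {X Q : Type*} [Fintype X] [DecidableEq X] [Fintype Q] [DecidableEq Q]

/-- A positive operator-valued measure with finite outcome set `X`. -/
def IsPOVM (M : X → Matrix Q Q ℂ) : Prop := (∀ x, (M x).PosSemidef) ∧ ∑ x, M x = 1

/-- The outcome probabilities `p(x) = Tr {γ M_x}`. -/
def outcomeProb (γ : Matrix Q Q ℂ) (M : X → Matrix Q Q ℂ) (x : X) : ℝ := (γ * M x).trace.re

/-- The block-diagonal matrix `∑ x, |x⟩⟨x| ⊗ S x`. -/
def cqMatrix (S : X → Matrix Q Q ℂ) : Matrix (X × Q) (X × Q) ℂ :=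
  ∑ x, Matrix.single x x (1 : ℂ) ⊗ₖ S x

/-- The partial trace over `Q`. -/
def traceOutQ (S : Matrix (X × Q) (X × Q) ℂ) : Matrix X X ℂ :=
  Matrix.of fun x y => ∑ q, S (x, q) (y, q)

/-- The operator `√γ M_x √γ`. -/
def sqrtSandwich (γ : Matrix Q Q ℂ) (M : X → Matrix Q Q ℂ) (x : X) : Matrix Q Q ℂ :=
  CFC.sqrt γ * M x * CFC.sqrt γ

/-- The forward state `γ_XQ = ∑ x, |x⟩⟨x| ⊗ √γ M_x √γ`. -/
def forwardState (γ : Matrix Q Q ℂ) (M : X → Matrix Q Q ℂ) : Matrix (X × Q) (X × Q) ℂ :=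
  cqMatrix (sqrtSandwich γ M)

/-- The quantum Bayesian inverse `√γ M_x √γ / Tr {γ M_x}`. -/
def bayesInverse (γ : Matrix Q Q ℂ) (M : X → Matrix Q Q ℂ) (x : X) : Matrix Q Q ℂ :=
  ((outcomeProb γ M x : ℂ))⁻¹ • sqrtSandwich γ M x

/-- The state `∑ x, τ(x) |x⟩⟨x| ⊗ √γ M_x √γ / Tr {γ M_x}`. -/
def retrodictedState (γ : Matrix Q Q ℂ) (M : X → Matrix Q Q ℂ) (τ : X → ℝ) :
    Matrix (X × Q) (X × Q) ℂ :=
  cqMatrix fun x => (τ x : ℂ) • bayesInverse γ M x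

/-- The diagonal matrix `∑ x, τ(x) |x⟩⟨x|`. -/
def classicalState (τ : X → ℝ) : Matrix X X ℂ := Matrix.diagonal fun x => (τ x : ℂ)

/-- The backward states with `X`-marginal `τ`: all `∑ x, τ(x) |x⟩⟨x| ⊗ σ_x` with density matrices
`σ_x`. -/
def backwardStates (X Q : Type*) [Fintype X] [DecidableEq X] [Fintype Q] [DecidableEq Q]
    (τ : X → ℝ) : Set (Matrix (X × Q) (X × Q) ℂ) :=
  {S | traceOutQ S = classicalState τ ∧
    ∃ σ : X → Matrix Q Q ℂ, (∀ x, IsDensity (σ x)) ∧ S = cqMatrix fun x => (τ x : ℂ) • σ x}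

end Measurement

end Retrodiction

end

noncomputable section

namespace Retrodiction

/-! ### Traces of positive semidefinite matrices. -/

section Trace

variable {n : Type*} [Fintype n]

/-! All operators involved are block diagonal over `X`, so each trace quantity is a sum over blocks
`A = τ(x) σ_x`, `B = √γ M_x √γ`, with traces `a = τ(x)` and `b = p(x) > 0`. It suffices to show in
each block that the quantum term is bounded by the classical term `a ^ α b ^ (1 - α)` or `a log₂ (a
/ b)`, with equality only for `A = (a / b) B`. Fixing the traces then determines every block, and
the minimizer is the same for all divergences.

The block bound is a tangent-line argument. The function `(α - 1) t ^ α` (or `t log₂ t`) is strictly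
convex and lies above its tangent at `c = a / b`. The tangent is affine, so after multiplication by
`B` its trace involves only `a` and `b`, and by the choice of `c` it equals the classical term. No
data-processing inequality is needed, and the factor `α - 1` treats both sides of `α = 1` together.

Scalar bounds become trace bounds through `klein`: `Tr {f(A) g(B)}` is a sum over pairs of
eigenvalues with nonnegative weights. The equality case is read off by comparison with a sum having
the same zeros whose trace is a squared Hilbert–Schmidt norm (`klein_eq_cfc`, `trace_mul_cfc_gap`).
The pair is `(A, B)` for Umegaki and Petz, `(B ^ s A B ^ s, B)` with `s = (1 - α) / (2 α)` for
sandwiched, and `(B ^ (-1/2) A B ^ (-1/2), B)` for geometric and Belavkin–Staszewski.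

If `supp A` is not inside `supp B`, either the value is `+∞`, or `α < 1` and the bound is strict.
`eval_gap` assembles the blocks. -/

theorem trace_re_eq_zero_iff {A : Matrix n n ℂ} (hA : A.PosSemidef) : A.trace.re = 0 ↔ A = 0 := by
  rw [← hA.trace_eq_zero_iff]
  have h := Complex.nonneg_iff.1 hA.trace_nonneg
  exact ⟨fun h' => Complex.ext h' h.2.symm, fun h' => by simp [h']⟩

theorem trace_re_nonneg {A : Matrix n n ℂ} (hA : A.PosSemidef) : 0 ≤ A.trace.re :=
  (Complex.nonneg_iff.1 hA.trace_nonneg).1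

end Trace

/-! ### Functional calculus of Hermitian matrices. -/

section FunctionalCalculus

variable {n : Type*} [Fintype n] [DecidableEq n]

/-- The spectrum is finite, so discontinuous functions such as `Real.logb 2`, negative powers and
the indicator of `0` are allowed in the functional calculus. -/
theorem continuousOn_spectrum (f : ℝ → ℝ) (A : Matrix n n ℂ) :
    ContinuousOn f (spectrum ℝ A) :=
  (Matrix.finite_real_spectrum (A := A)).continuousOn f

theorem cfc_mul_cfc (f g : ℝ → ℝ) (A : Matrix n n ℂ) :
    cfc f A * cfc g A = cfc (fun t => f t * g t) A :=
  (cfc_mul f g A (continuousOn_spectrum f A) (continuousOn_spectrum g A)).symm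

theorem isHermitian_cfc (f : ℝ → ℝ) (A : Matrix n n ℂ) : (cfc f A).IsHermitian :=
  cfc_predicate f A

/-- Functions that agree on `[0, ∞)` have the same value at a positive semidefinite matrix. -/
theorem cfc_congr_of_posSemidef {f g : ℝ → ℝ} {A : Matrix n n ℂ} (hA : A.PosSemidef)
    (h : ∀ t, 0 ≤ t → f t = g t) : cfc f A = cfc g A :=
  cfc_congr fun t ht => h t (spectrum_nonneg_of_nonneg (nonneg_iff_posSemidef.2 hA) ht)

theorem rpow_eq_cfc {A : Matrix n n ℂ} (hA : A.PosSemidef) (s : ℝ) :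
    A ^ s = cfc (fun t : ℝ => t ^ s) A :=
  CFC.rpow_eq_cfc_real (nonneg_iff_posSemidef.2 hA)

theorem posSemidef_rpow (A : Matrix n n ℂ) (s : ℝ) : (A ^ s).PosSemidef :=
  nonneg_iff_posSemidef.1 CFC.rpow_nonneg

theorem cfc_id_of_isHermitian {A : Matrix n n ℂ} (hA : A.IsHermitian) :
    cfc (fun t : ℝ => t) A = A :=
  cfc_id' ℝ A hA

theorem cfc_one_of_isHermitian {A : Matrix n n ℂ} (hA : A.IsHermitian) :
    cfc (fun _ : ℝ => (1 : ℝ)) A = 1 :=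
  cfc_const_one ℝ A (show IsSelfAdjoint A from hA)

theorem mul_cfc_self (f : ℝ → ℝ) {A : Matrix n n ℂ} (hA : A.IsHermitian) :
    A * cfc f A = cfc (fun t => t * f t) A := by
  rw [← cfc_mul_cfc, cfc_id_of_isHermitian hA]

theorem cfc_mul_self (f : ℝ → ℝ) {A : Matrix n n ℂ} (hA : A.IsHermitian) :
    cfc f A * A = cfc (fun t => f t * t) A := by
  rw [← cfc_mul_cfc, cfc_id_of_isHermitian hA]

theorem exists_polynomial_eval_eq {s : Set ℝ} (hs : s.Finite) (f : ℝ → ℝ) :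
    ∃ q : Polynomial ℝ, ∀ t ∈ s, q.eval t = f t := by
  classical
  refine ⟨Lagrange.interpolate hs.toFinset id f, fun t ht => ?_⟩
  exact Lagrange.eval_interpolate_at_node (v := id) f Function.injective_id.injOn
    (hs.mem_toFinset.2 ht)

theorem cfc_eq_aeval {A : Matrix n n ℂ} (hA : A.IsHermitian) {f : ℝ → ℝ} {q : Polynomial ℝ}
    (h : ∀ t ∈ spectrum ℝ A, q.eval t = f t) : cfc f A = Polynomial.aeval A q := by
  rw [← cfc_polynomial q A hA]
  exact cfc_congr fun t ht => (h t ht).symm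

theorem mul_aeval_mul {R : Type*} [Ring R] [Algebra ℝ R] (a b : R) (q : Polynomial ℝ) :
    a * Polynomial.aeval (b * a) q = Polynomial.aeval (a * b) q * a := by
  induction q using Polynomial.induction_on with
  | C r => simp [Algebra.commutes]
  | add p q hp hq => simp [mul_add, add_mul, hp, hq]
  | monomial k r h =>
    simp only [map_mul, Polynomial.aeval_C, map_pow, Polynomial.aeval_X] at h ⊢
    rw [pow_succ (b * a), ← mul_assoc (algebraMap ℝ R r), ← mul_assoc a, h, pow_succ (a * b)]
    simp only [mul_assoc]

/-- One polynomial interpolates `f` on both spectra, and for polynomials the identity follows from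
`a (b a) ^ k = (a b) ^ k a`. -/
theorem mul_cfc_conjTranspose_mul_self (f : ℝ → ℝ) (Z : Matrix n n ℂ) :
    Z * cfc f (Zᴴ * Z) = cfc f (Z * Zᴴ) * Z := by
  obtain ⟨q, hq⟩ := exists_polynomial_eval_eq
    ((Matrix.finite_real_spectrum (A := Zᴴ * Z)).union
      (Matrix.finite_real_spectrum (A := Z * Zᴴ))) f
  rw [cfc_eq_aeval (isHermitian_conjTranspose_mul_self Z) fun t ht => hq t (.inl ht),
    cfc_eq_aeval (isHermitian_mul_conjTranspose_self Z) fun t ht => hq t (.inr ht)]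
  exact mul_aeval_mul Z Zᴴ q

/-- The traces `Tr {f(A) g(B)}` are integrals of `f ⊗ g` against a nonnegative weight on pairs of
eigenvalues. -/
theorem exists_eigenvalue_weights {A B : Matrix n n ℂ} (hA : A.IsHermitian) (hB : B.IsHermitian) :
    ∃ w : n → n → ℝ, (∀ i j, 0 ≤ w i j) ∧ ∀ f g : ℝ → ℝ, (cfc f A * cfc g B).trace.re =
      ∑ i, ∑ j, w i j * (f (hA.eigenvalues i) * g (hB.eigenvalues j)) := by
  set U : Matrix n n ℂ := hA.eigenvectorUnitary.1
  set V : Matrix n n ℂ := hB.eigenvectorUnitary.1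
  refine ⟨fun i j => Complex.normSq ((Uᴴ * V) i j), fun i j => Complex.normSq_nonneg _,
    fun f g => ?_⟩
  have hAf : cfc f A = U * diagonal (fun i => (f (hA.eigenvalues i) : ℂ)) * Uᴴ := by
    rw [hA.cfc_eq]; rfl
  have hBg : cfc g B = V * diagonal (fun i => (g (hB.eigenvalues i) : ℂ)) * Vᴴ := by
    rw [hB.cfc_eq]; rfl
  have hW : Vᴴ * U = (Uᴴ * V)ᴴ := by simp
  have key : (cfc f A * cfc g B).trace =
      (diagonal (fun i => (f (hA.eigenvalues i) : ℂ)) * (Uᴴ * V) *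
        diagonal (fun i => (g (hB.eigenvalues i) : ℂ)) * (Uᴴ * V)ᴴ).trace := by
    rw [hAf, hBg, ← hW, Matrix.mul_assoc U, Matrix.mul_assoc U, Matrix.trace_mul_comm]
    simp only [Matrix.mul_assoc]
  rw [key, Matrix.trace, Complex.re_sum]
  refine Finset.sum_congr rfl fun i _ => ?_
  rw [Matrix.diag_apply, Matrix.mul_apply, Complex.re_sum]
  refine Finset.sum_congr rfl fun j _ => ?_
  rw [Matrix.mul_diagonal, Matrix.diagonal_mul, Matrix.conjTranspose_apply]
  have : (f (hA.eigenvalues i) : ℂ) * (Uᴴ * V) i j * (g (hB.eigenvalues j) : ℂ) *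
      star ((Uᴴ * V) i j) = ((Complex.normSq ((Uᴴ * V) i j) *
        (f (hA.eigenvalues i) * g (hB.eigenvalues j)) : ℝ) : ℂ) := by
    push_cast
    rw [← Complex.mul_conj, starRingEnd_apply]
    ring
  rw [this, Complex.ofReal_re]

end FunctionalCalculus

/-! ### Scalar tangent inequalities with their equality cases. -/

section Tangent

/-- Strict convexity of `t ↦ (α - 1) t ^ α` on `[0, ∞)`, via the tangent at `c`. -/
theorem rpow_tangent_gap {α c t : ℝ} (hα : 0 < α) (hα1 : α ≠ 1) (hc : 0 < c) (ht : 0 ≤ t) :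
    0 ≤ (α - 1) * (t ^ α - (α * c ^ (α - 1) * t + (1 - α) * c ^ α)) ∧
      ((α - 1) * (t ^ α - (α * c ^ (α - 1) * t + (1 - α) * c ^ α)) = 0 ↔ t = c) := by
  have hcα : 0 < c ^ α := Real.rpow_pos_of_pos hc α
  -- Rescaling by `c` moves the point of tangency to `1`, where the claim is the strict Bernoulli
  -- inequality.
  have hform : (α - 1) * (t ^ α - (α * c ^ (α - 1) * t + (1 - α) * c ^ α)) =
      c ^ α * ((α - 1) * ((1 + (t / c - 1)) ^ α - (1 + α * (t / c - 1)))) := by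
    rw [add_sub_cancel, Real.div_rpow ht hc.le, Real.rpow_sub_one hc.ne']
    field_simp
    ring
  have hs : -1 ≤ t / c - 1 := by linarith [div_nonneg ht hc.le]
  rw [hform]
  by_cases h : t = c
  · subst h
    simp [div_self hc.ne']
  · have hs0 : t / c - 1 ≠ 0 := by
      rw [sub_ne_zero, Ne, div_eq_one_iff_eq hc.ne']
      exact h
    have hpos : 0 < (α - 1) * ((1 + (t / c - 1)) ^ α - (1 + α * (t / c - 1))) := by
      rcases lt_or_gt_of_ne hα1 with h1 | h1
      · exact mul_pos_of_neg_of_neg (by linarith)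
          (by linarith [rpow_one_add_lt_one_add_mul_self hs hs0 hα h1])
      · exact mul_pos (by linarith)
          (by linarith [one_add_mul_self_lt_rpow_one_add hs hs0 h1])
    have := mul_pos hcα hpos
    exact ⟨this.le, fun h' => absurd h' this.ne', fun h' => absurd h' h⟩

/-- For `y > 0` this is `y` times the tangent bound at `t = x / y`. At `y = 0` the power term
vanishes; for `α < 1` a positive multiple of `x` remains, so no support condition is needed there.
-/
theorem rpow_perspective_gap {α c x y : ℝ} (hα : 0 < α) (hα1 : α ≠ 1) (hc : 0 < c) (hx : 0 ≤ x)
    (hy : 0 ≤ y) (hxy : ¬ α < 1 → y = 0 → x = 0) :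
    0 ≤ (α - 1) * (x ^ α * y ^ (1 - α) - (α * c ^ (α - 1) * x + (1 - α) * c ^ α * y)) ∧
      ((α - 1) * (x ^ α * y ^ (1 - α) - (α * c ^ (α - 1) * x + (1 - α) * c ^ α * y)) = 0 ↔
        x = c * y) := by
  rcases hy.eq_or_lt with rfl | hy
  · have h1 : (1 - α) ≠ 0 := sub_ne_zero.2 hα1.symm
    have hk : 0 < α * c ^ (α - 1) := mul_pos hα (Real.rpow_pos_of_pos hc _)
    rw [Real.zero_rpow h1]
    by_cases hlt : α < 1
    · have hform : (α - 1) * (x ^ α * 0 - (α * c ^ (α - 1) * x + (1 - α) * c ^ α * 0)) =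
          (1 - α) * (α * c ^ (α - 1)) * x := by ring
      have hk' : 0 < (1 - α) * (α * c ^ (α - 1)) := mul_pos (by linarith) hk
      rw [hform]
      exact ⟨mul_nonneg hk'.le hx, by simp [hk'.ne']⟩
    · simp [hxy hlt rfl]
  · obtain ⟨h0, h1⟩ := rpow_tangent_gap hα hα1 hc (div_nonneg hx hy.le)
    have hform : (α - 1) * (x ^ α * y ^ (1 - α) - (α * c ^ (α - 1) * x + (1 - α) * c ^ α * y)) =
        y * ((α - 1) * ((x / y) ^ α - (α * c ^ (α - 1) * (x / y) + (1 - α) * c ^ α))) := by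
      rw [Real.div_rpow hx hy.le, Real.rpow_sub hy, Real.rpow_one]
      field_simp
    rw [hform, mul_eq_zero, or_iff_right hy.ne', h1, div_eq_iff hy.ne']
    exact ⟨mul_nonneg hy.le h0, Iff.rfl⟩

/-- For `y > 0` this is `y` times the tangent bound at `t = x / y ^ (1 / α)`. The exponents are
those produced by the sandwich. -/
theorem rpow_sandwich_gap {α c x y : ℝ} (hα : 0 < α) (hα1 : α ≠ 1) (hc : 0 < c) (hx : 0 ≤ x)
    (hy : 0 ≤ y) (hxy : y = 0 → x = 0) :
    0 ≤ (α - 1) * (x ^ α - (α * c ^ (α - 1) * (x * y ^ ((α - 1) / α)) + (1 - α) * c ^ α * y)) ∧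
      ((α - 1) * (x ^ α - (α * c ^ (α - 1) * (x * y ^ ((α - 1) / α)) + (1 - α) * c ^ α * y)) = 0 ↔
        x = c * y ^ (1 / α)) := by
  rcases hy.eq_or_lt with rfl | hy
  · simp [hxy rfl, hα.ne']
  · have hy' : 0 < y ^ (1 / α) := Real.rpow_pos_of_pos hy _
    obtain ⟨h0, h1⟩ := rpow_tangent_gap hα hα1 hc (div_nonneg hx hy'.le)
    have hpow : (y ^ (1 / α)) ^ α = y := by
      rw [← Real.rpow_mul hy.le, one_div_mul_cancel hα.ne', Real.rpow_one]
    have hsub : y ^ ((α - 1) / α) = y / y ^ (1 / α) := by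
      rw [sub_div, div_self hα.ne', Real.rpow_sub hy, Real.rpow_one]
    have hform : (α - 1) *
          (x ^ α - (α * c ^ (α - 1) * (x * y ^ ((α - 1) / α)) + (1 - α) * c ^ α * y)) =
        y * ((α - 1) * ((x / y ^ (1 / α)) ^ α -
          (α * c ^ (α - 1) * (x / y ^ (1 / α)) + (1 - α) * c ^ α))) := by
      rw [Real.div_rpow hx hy'.le, hpow, hsub]
      field_simp
    rw [hform, mul_eq_zero, or_iff_right hy.ne', h1, div_eq_iff hy'.ne']
    exact ⟨mul_nonneg hy.le h0, Iff.rfl⟩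

theorem mul_logb_tangent_gap {c t : ℝ} (hc : 0 < c) (ht : 0 ≤ t) :
    0 ≤ t * Real.logb 2 t - (t * Real.logb 2 c + (t - c) / Real.log 2) ∧
      (t * Real.logb 2 t - (t * Real.logb 2 c + (t - c) / Real.log 2) = 0 ↔ t = c) := by
  have h2 : 0 < Real.log 2 := Real.log_pos one_lt_two
  have hform : t * Real.logb 2 t - (t * Real.logb 2 c + (t - c) / Real.log 2) =
      (t * Real.log t - t * Real.log c - (t - c)) / Real.log 2 := by
    simp only [Real.logb]
    field_simp
    ring
  rw [hform, div_eq_zero_iff, or_iff_left h2.ne']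
  rcases ht.eq_or_lt with rfl | ht
  · simp [div_nonneg hc.le h2.le, hc.ne, hc.ne']
  by_cases h : t = c
  · subst h
    simp
  · have hlog := Real.log_lt_sub_one_of_pos (div_pos hc ht)
      (by rw [Ne, div_eq_one_iff_eq ht.ne']; exact Ne.symm h)
    rw [Real.log_div hc.ne' ht.ne'] at hlog
    have h3 : t * (Real.log c - Real.log t) < c - t := by
      calc _ < t * (c / t - 1) := mul_lt_mul_of_pos_left hlog ht
        _ = c - t := by field_simp
    have h4 : 0 < t * Real.log t - t * Real.log c - (t - c) := by linarith
    exact ⟨(div_pos h4 h2).le, fun h' => absurd h' h4.ne', fun h' => absurd h' h⟩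

/-- The tangent to `t log₂ t` is taken at the point `c y`. -/
theorem logb_perspective_gap {c x y : ℝ} (hc : 0 < c) (hx : 0 ≤ x) (hy : 0 ≤ y)
    (hxy : y = 0 → x = 0) :
    0 ≤ x * Real.logb 2 x - x * Real.logb 2 y -
        (x * Real.logb 2 c + (x - c * y) / Real.log 2) ∧
      (x * Real.logb 2 x - x * Real.logb 2 y -
        (x * Real.logb 2 c + (x - c * y) / Real.log 2) = 0 ↔ x = c * y) := by
  rcases hy.eq_or_lt with rfl | hy
  · simp [hxy rfl]
  · obtain ⟨h0, h1⟩ := mul_logb_tangent_gap (mul_pos hc hy) hx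
    rw [Real.logb_mul hc.ne' hy.ne'] at h0 h1
    have hform : x * Real.logb 2 x - x * Real.logb 2 y -
          (x * Real.logb 2 c + (x - c * y) / Real.log 2) =
        x * Real.logb 2 x - (x * (Real.logb 2 c + Real.logb 2 y) + (x - c * y) / Real.log 2) := by
      ring
    rw [hform]
    exact ⟨h0, h1⟩

end Tangent

/-! ### Kernel projections and Klein's inequality. -/

section Klein

variable {n : Type*} [Fintype n] [DecidableEq n]

theorem isHermitian_kerProj (B : Matrix n n ℂ) : (kerProj B).IsHermitian :=
  isHermitian_cfc _ B

theorem kerProj_mul_self (B : Matrix n n ℂ) : kerProj B * kerProj B = kerProj B := by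
  rw [kerProj, cfc_mul_cfc]
  congr 1
  funext t
  split_ifs <;> simp

theorem one_sub_kerProj {B : Matrix n n ℂ} (hB : B.IsHermitian) :
    1 - kerProj B = cfc (fun t : ℝ => if t = 0 then 0 else 1) B := by
  rw [kerProj, ← cfc_one_of_isHermitian hB,
    ← cfc_sub _ _ B (continuousOn_spectrum _ B) (continuousOn_spectrum _ B)]
  congr 1
  funext t
  split_ifs <;> simp

/-- Support inclusion becomes an algebraic identity, which star homomorphisms transport. -/
theorem suppLE_iff {A B : Matrix n n ℂ} (hB : B.IsHermitian) :
    SuppLE A B ↔ A * kerProj B = 0 := by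
  constructor
  · intro h
    have hBK : B * kerProj B = 0 := by
      rw [kerProj, mul_cfc_self _ hB, ← cfc_zero ℝ B]
      congr 1
      funext t
      by_cases ht : t = 0 <;> simp [ht]
    refine Matrix.ext_of_mulVec_single fun i => ?_
    rw [← Matrix.mulVec_mulVec, h _ (by rw [Matrix.mulVec_mulVec, hBK, Matrix.zero_mulVec]),
      Matrix.zero_mulVec]
  · intro h v hv
    have h1 : (1 : Matrix n n ℂ) = kerProj B + cfc (fun t : ℝ => t⁻¹) B * B := by
      rw [cfc_mul_self _ hB, ← sub_eq_iff_eq_add', one_sub_kerProj hB]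
      congr 1
      funext t
      by_cases ht : t = 0 <;> simp [ht]
    have h2 : v = kerProj B *ᵥ v := by
      conv_lhs => rw [← Matrix.one_mulVec v, h1, Matrix.add_mulVec, ← Matrix.mulVec_mulVec, hv,
        Matrix.mulVec_zero, add_zero]
    rw [h2, Matrix.mulVec_mulVec, h, Matrix.zero_mulVec]

theorem exists_weights {A B : Matrix n n ℂ} (hA : A.PosSemidef) (hB : B.PosSemidef) :
    ∃ (w : n → n → ℝ) (a b : n → ℝ), (∀ i j, 0 ≤ w i j) ∧ (∀ i, 0 ≤ a i) ∧ (∀ j, 0 ≤ b j) ∧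
      (∀ f g : ℝ → ℝ, (cfc f A * cfc g B).trace.re = ∑ i, ∑ j, w i j * (f (a i) * g (b j))) ∧
      (SuppLE A B → ∀ i j, w i j ≠ 0 → b j = 0 → a i = 0) := by
  obtain ⟨w, hw, htr⟩ := exists_eigenvalue_weights hA.1 hB.1
  refine ⟨w, hA.1.eigenvalues, hB.1.eigenvalues, hw, hA.eigenvalues_nonneg,
    hB.eigenvalues_nonneg, htr, fun hAB i j hij hj => ?_⟩
  -- The inclusion says `Tr {A K} = 0` for the kernel projection `K` of `B`. This trace is a sum of
  -- nonnegative terms, so each of them vanishes.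
  have h0 := htr (fun t => t) (fun t => if t = 0 then 1 else 0)
  have h1 : A * cfc (fun t : ℝ => if t = 0 then 1 else 0) B = 0 := (suppLE_iff hB.1).1 hAB
  rw [cfc_id_of_isHermitian hA.1, h1, Matrix.trace_zero, Complex.zero_re] at h0
  have hnn : ∀ i j, 0 ≤ w i j * (hA.1.eigenvalues i *
      (if hB.1.eigenvalues j = 0 then 1 else 0 : ℝ)) := fun i j =>
    mul_nonneg (hw i j) (mul_nonneg (hA.eigenvalues_nonneg i) (by split_ifs <;> simp))
  have h2 := (Finset.sum_eq_zero_iff_of_nonneg fun i _ => Finset.sum_nonneg fun j _ => hnn i j).1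
    h0.symm i (Finset.mem_univ i)
  have h3 := (Finset.sum_eq_zero_iff_of_nonneg fun j _ => hnn i j).1 h2 j (Finset.mem_univ j)
  simpa [hij, hj] using h3

omit [DecidableEq n] in
theorem sum_weights {ι : Type*} [Fintype ι] (w : n → n → ℝ) (a b : n → ℝ) (f g : ι → ℝ → ℝ) :
    ∑ k, ∑ i, ∑ j, w i j * (f k (a i) * g k (b j)) =
      ∑ p : n × n, w p.1 p.2 * ∑ k, f k (a p.1) * g k (b p.2) := by
  rw [Fintype.sum_prod_type, Finset.sum_comm]
  refine Finset.sum_congr rfl fun i _ => ?_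
  rw [Finset.sum_comm]
  simp only [Finset.mul_sum]

/-- Klein's inequality: a function `∑ k, f k x * g k y` that is nonnegative on the pairs of
eigenvalues gives a nonnegative trace, which vanishes exactly when the trace of any other such
function with the same zeros does. -/
theorem klein {A B : Matrix n n ℂ} (hA : A.PosSemidef) (hB : B.PosSemidef) {ι κ : Type*}
    [Fintype ι] [Fintype κ] (f g : ι → ℝ → ℝ) (f' g' : κ → ℝ → ℝ) (C : Prop)
    (hC : C → SuppLE A B)
    (hfg : ∀ x y, 0 ≤ x → 0 ≤ y → (C → y = 0 → x = 0) → 0 ≤ ∑ k, f k x * g k y)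
    (hfg' : ∀ x y, 0 ≤ x → 0 ≤ y → 0 ≤ ∑ k, f' k x * g' k y)
    (hzero : ∀ x y, 0 ≤ x → 0 ≤ y → (C → y = 0 → x = 0) →
      (∑ k, f k x * g k y = 0 ↔ ∑ k, f' k x * g' k y = 0)) :
    0 ≤ ∑ k, (cfc (f k) A * cfc (g k) B).trace.re ∧
      (∑ k, (cfc (f k) A * cfc (g k) B).trace.re = 0 ↔
        ∑ k, (cfc (f' k) A * cfc (g' k) B).trace.re = 0) := by
  obtain ⟨w, a, b, hw, ha, hb, htr, hsupp⟩ := exists_weights hA hB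
  have hpair : ∀ p : n × n, w p.1 p.2 ≠ 0 → C → b p.2 = 0 → a p.1 = 0 :=
    fun p hp hc => hsupp (hC hc) p.1 p.2 hp
  -- The support condition is known only for pairs of positive weight; the others contribute
  -- nothing.
  have h1 : ∀ p : n × n, 0 ≤ w p.1 p.2 * ∑ k, f k (a p.1) * g k (b p.2) := fun p => by
    by_cases hp : w p.1 p.2 = 0
    · simp [hp]
    · exact mul_nonneg (hw _ _) (hfg _ _ (ha _) (hb _) (hpair p hp))
  simp only [htr]
  rw [sum_weights, sum_weights]
  refine ⟨Finset.sum_nonneg fun p _ => h1 p, ?_⟩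
  rw [Finset.sum_eq_zero_iff_of_nonneg fun p _ => h1 p,
    Finset.sum_eq_zero_iff_of_nonneg fun p _ => mul_nonneg (hw _ _) (hfg' _ _ (ha _) (hb _))]
  refine forall₂_congr fun p _ => ?_
  by_cases hp : w p.1 p.2 = 0
  · simp [hp]
  · rw [mul_eq_zero, mul_eq_zero, hzero _ _ (ha _) (hb _) (hpair p hp)]

end Klein

/-! ### Klein's inequality with equality case; Umegaki and Petz bounds. -/

section Gap

variable {n : Type*} [Fintype n] [DecidableEq n]

theorem cfc_smul_const (r : ℝ) (f : ℝ → ℝ) (A : Matrix n n ℂ) :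
    cfc (fun t => r * f t) A = r • cfc f A :=
  cfc_const_mul r f A (continuousOn_spectrum f A)

theorem cfc_smul_id (r : ℝ) {A : Matrix n n ℂ} (hA : A.IsHermitian) :
    cfc (fun t => r * t) A = r • A := by
  rw [cfc_smul_const r (fun t => t), cfc_id_of_isHermitian hA]

omit [DecidableEq n] in
theorem trace_re_smul (r : ℝ) (A : Matrix n n ℂ) : (r • A).trace.re = r * A.trace.re := by
  simp [Matrix.trace_smul]

/-- The comparison function is `(x - h y) ^ 2`, whose trace is the squared Hilbert–Schmidt norm of
`A - h(B)`. The proposition `C` records when the support condition is available. -/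
theorem klein_eq_cfc {A B : Matrix n n ℂ} (hA : A.PosSemidef) (hB : B.PosSemidef) {ι : Type*}
    [Fintype ι] (f g : ι → ℝ → ℝ) (h : ℝ → ℝ) (C : Prop) (hC : C → SuppLE A B)
    (hfg : ∀ x y, 0 ≤ x → 0 ≤ y → (C → y = 0 → x = 0) →
      0 ≤ ∑ k, f k x * g k y ∧ (∑ k, f k x * g k y = 0 ↔ x = h y)) :
    0 ≤ ∑ k, (cfc (f k) A * cfc (g k) B).trace.re ∧
      (∑ k, (cfc (f k) A * cfc (g k) B).trace.re = 0 ↔ A = cfc h B) := by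
  have hsq : ∀ x y : ℝ, ∑ k, (![fun t => t * t, fun t => t, fun _ => 1] : Fin 3 → ℝ → ℝ) k x *
      (![fun _ => 1, fun t => -2 * h t, fun t => h t * h t] : Fin 3 → ℝ → ℝ) k y =
      (x - h y) * (x - h y) := fun x y => by
    simp [Fin.sum_univ_three]
    ring
  have key := klein hA hB f g _ _ C hC (fun x y hx hy hxy => (hfg x y hx hy hxy).1)
    (fun x y _ _ => (hsq x y).symm ▸ mul_self_nonneg _)
    (fun x y hx hy hxy => by
      rw [hsq, (hfg x y hx hy hxy).2, mul_self_eq_zero, sub_eq_zero])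
  refine ⟨key.1, key.2.trans ?_⟩
  have hH := isHermitian_cfc h B
  have htr : ∑ k, (cfc ((![fun t => t * t, fun t => t, fun _ => 1] : Fin 3 → ℝ → ℝ) k) A *
      cfc ((![fun _ => 1, fun t => -2 * h t, fun t => h t * h t] : Fin 3 → ℝ → ℝ) k) B).trace.re =
      ((A - cfc h B)ᴴ * (A - cfc h B)).trace.re := by
    simp only [Fin.sum_univ_three, Matrix.cons_val_zero, Matrix.cons_val_one, Matrix.cons_val]
    rw [cfc_smul_const, ← cfc_mul_cfc, ← cfc_mul_cfc, cfc_id_of_isHermitian hA.1,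
      cfc_one_of_isHermitian hA.1, cfc_one_of_isHermitian hB.1, Matrix.conjTranspose_sub, hA.1.eq,
      hH.eq, Matrix.sub_mul, Matrix.mul_sub, Matrix.mul_sub, Matrix.trace_sub, Matrix.trace_sub,
      Matrix.trace_sub, Matrix.trace_mul_comm (cfc h B) A, Matrix.mul_smul, Matrix.mul_one,
      Matrix.one_mul, trace_re_smul]
    simp only [Complex.sub_re]
    ring
  rw [htr, trace_re_eq_zero_iff (posSemidef_conjTranspose_mul_self _),
    Matrix.conjTranspose_mul_self_eq_zero, sub_eq_zero]

/-- `q` obeys the sharp Rényi bound `a ^ α b ^ (1 - α)`, with equality only for proportional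
operators. -/
def RenyiGap (α q : ℝ) (A B : Matrix n n ℂ) : Prop :=
  0 ≤ (α - 1) * (q - A.trace.re ^ α * B.trace.re ^ (1 - α)) ∧
    (q = A.trace.re ^ α * B.trace.re ^ (1 - α) ↔ A = (A.trace.re / B.trace.re) • B)

/-- `d` obeys the sharp bound `a log₂ (a / b)`, with equality only for proportional operators. -/
def EntropyGap (d : ℝ) (A B : Matrix n n ℂ) : Prop :=
  0 ≤ d - A.trace.re * Real.logb 2 (A.trace.re / B.trace.re) ∧
    (d = A.trace.re * Real.logb 2 (A.trace.re / B.trace.re) ↔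
      A = (A.trace.re / B.trace.re) • B)

omit [DecidableEq n] in
theorem renyiGap_zero {α : ℝ} (hα : 0 < α) (B : Matrix n n ℂ) :
    RenyiGap α 0 (0 : Matrix n n ℂ) B := by
  simp [RenyiGap, Real.zero_rpow hα.ne']

omit [DecidableEq n] in
theorem entropyGap_zero (B : Matrix n n ℂ) : EntropyGap 0 (0 : Matrix n n ℂ) B := by
  simp [EntropyGap]

omit [DecidableEq n] in
-- At `c = Tr A / Tr B` the tangent takes exactly the value of the classical term.
theorem renyiGap_of_tangent {α q : ℝ} (hα1 : α ≠ 1) {A B : Matrix n n ℂ}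
    (ha : 0 < A.trace.re) (hb : 0 < B.trace.re) {c : ℝ} (hc : c = A.trace.re / B.trace.re)
    (h : 0 ≤ (α - 1) * (q - (α * c ^ (α - 1) * A.trace.re + (1 - α) * c ^ α * B.trace.re)) ∧
      ((α - 1) * (q - (α * c ^ (α - 1) * A.trace.re + (1 - α) * c ^ α * B.trace.re)) = 0 ↔
        A = c • B)) :
    RenyiGap α q A B := by
  have hc0 : 0 < c := hc ▸ div_pos ha hb
  have hval : α * c ^ (α - 1) * A.trace.re + (1 - α) * c ^ α * B.trace.re =
      A.trace.re ^ α * B.trace.re ^ (1 - α) := by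
    have hac : A.trace.re = c * B.trace.re := by rw [hc]; field_simp
    rw [hac, Real.mul_rpow hc0.le hb.le, Real.rpow_sub_one hc0.ne', mul_assoc (c ^ α),
      ← Real.rpow_add hb, add_sub_cancel, Real.rpow_one]
    field_simp
    ring
  rw [hval, mul_eq_zero, or_iff_right (sub_ne_zero.2 hα1), sub_eq_zero, hc] at h
  exact h

omit [DecidableEq n] in
theorem entropyGap_of_tangent {d : ℝ} {A B : Matrix n n ℂ} (hb : 0 < B.trace.re) {c : ℝ}
    (hc : c = A.trace.re / B.trace.re)
    (h : 0 ≤ d - (A.trace.re * Real.logb 2 c + (A.trace.re - c * B.trace.re) / Real.log 2) ∧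
      (d - (A.trace.re * Real.logb 2 c + (A.trace.re - c * B.trace.re) / Real.log 2) = 0 ↔
        A = c • B)) :
    EntropyGap d A B := by
  have hac : A.trace.re - c * B.trace.re = 0 := by rw [hc]; field_simp; ring
  rw [hac, zero_div, add_zero, sub_eq_zero, hc] at h
  exact h

theorem umegaki_gap {A B : Matrix n n ℂ} (hA : A.PosSemidef) (hB : B.PosSemidef)
    (hb : 0 < B.trace.re) (hAB : SuppLE A B) :
    EntropyGap (A * (log2 A - log2 B)).trace.re A B := by
  -- A block with `τ(x) = 0` is treated apart, because the tangent needs `c > 0`.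
  rcases (trace_re_nonneg hA).eq_or_lt with ha | ha
  · rw [(trace_re_eq_zero_iff hA).1 ha.symm]
    simpa using entropyGap_zero B
  obtain ⟨c, hc⟩ : ∃ c, c = A.trace.re / B.trace.re := ⟨_, rfl⟩
  have hc0 : 0 < c := hc ▸ div_pos ha hb
  refine entropyGap_of_tangent hb hc ?_
  -- The scalar gap is split into products `f k x * g k y`, one for each trace in the operator
  -- inequality.
  have hsum : ∀ x y : ℝ, ∑ k, (![fun t => t * Real.logb 2 t, fun t => t, fun t => t, fun _ => 1] :
      Fin 4 → ℝ → ℝ) k x * (![fun _ => 1, fun t => (-1) * Real.logb 2 t,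
        fun _ => -(Real.logb 2 c + 1 / Real.log 2) * 1, fun t => c / Real.log 2 * t] :
      Fin 4 → ℝ → ℝ) k y = x * Real.logb 2 x - x * Real.logb 2 y -
        (x * Real.logb 2 c + (x - c * y) / Real.log 2) := fun x y => by
    simp [Fin.sum_univ_four]
    ring
  have key := klein_eq_cfc hA hB _ _ (fun y => c * y) True (fun _ => hAB)
    (fun x y hx hy hxy => by
      rw [hsum]
      exact logb_perspective_gap hc0 hx hy (hxy trivial))
  simp only [Fin.sum_univ_four, Matrix.cons_val_zero, Matrix.cons_val_one, Matrix.cons_val] at key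
  simp only [cfc_smul_const, cfc_id_of_isHermitian hA.1, cfc_smul_id _ hB.1,
    cfc_one_of_isHermitian hA.1, cfc_one_of_isHermitian hB.1, ← mul_cfc_self _ hA.1,
    Matrix.mul_smul, Matrix.mul_one, Matrix.one_mul, trace_re_smul] at key
  simp only [log2, Matrix.mul_sub, Matrix.trace_sub, Complex.sub_re]
  convert key using 2 <;> ring_nf

theorem petz_gap {α : ℝ} (hα : 0 < α) (hα1 : α ≠ 1) {A B : Matrix n n ℂ} (hA : A.PosSemidef)
    (hB : B.PosSemidef) (hb : 0 < B.trace.re) (hAB : α < 1 ∨ SuppLE A B) :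
    RenyiGap α (A ^ α * B ^ (1 - α)).trace.re A B := by
  rw [rpow_eq_cfc hA, rpow_eq_cfc hB]
  rcases (trace_re_nonneg hA).eq_or_lt with ha | ha
  · rw [(trace_re_eq_zero_iff hA).1 ha.symm]
    simpa [Real.zero_rpow hα.ne'] using renyiGap_zero hα B
  obtain ⟨c, hc⟩ : ∃ c, c = A.trace.re / B.trace.re := ⟨_, rfl⟩
  have hc0 : 0 < c := hc ▸ div_pos ha hb
  refine renyiGap_of_tangent hα1 ha hb hc ?_
  have hsum : ∀ x y : ℝ, ∑ k, (![fun t => t ^ α, fun t => t, fun _ => 1] :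
      Fin 3 → ℝ → ℝ) k x * (![fun t => (α - 1) * t ^ (1 - α),
        fun _ => -(α - 1) * (α * c ^ (α - 1)) * 1, fun t => -(α - 1) * ((1 - α) * c ^ α) * t] :
      Fin 3 → ℝ → ℝ) k y =
        (α - 1) * (x ^ α * y ^ (1 - α) - (α * c ^ (α - 1) * x + (1 - α) * c ^ α * y)) :=
    fun x y => by
      simp [Fin.sum_univ_three]
      ring
  have key := klein_eq_cfc hA hB _ _ (fun y => c * y) (¬ α < 1) (fun h => hAB.resolve_left h)
    (fun x y hx hy hxy => by
      rw [hsum]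
      exact rpow_perspective_gap hα hα1 hc0 hx hy hxy)
  simp only [Fin.sum_univ_three, Matrix.cons_val_zero, Matrix.cons_val_one, Matrix.cons_val] at key
  simp only [cfc_smul_const, cfc_id_of_isHermitian hA.1, cfc_smul_id _ hB.1,
    cfc_one_of_isHermitian hA.1, cfc_one_of_isHermitian hB.1,
    Matrix.mul_smul, Matrix.mul_one, Matrix.one_mul, trace_re_smul] at key
  convert key using 2 <;> ring_nf

end Gap

/-! ### Generalized inverses and traces on the support. -/

section Support

variable {n : Type*} [Fintype n] [DecidableEq n]

theorem cfc_mul_kerProj {f : ℝ → ℝ} (hf : f 0 = 0) (B : Matrix n n ℂ) :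
    cfc f B * kerProj B = 0 := by
  rw [kerProj, cfc_mul_cfc, ← cfc_zero ℝ B]
  congr 1
  funext t
  by_cases ht : t = 0 <;> simp [ht, hf]

theorem kerProj_mul_cfc {f : ℝ → ℝ} (hf : f 0 = 0) (B : Matrix n n ℂ) :
    kerProj B * cfc f B = 0 := by
  rw [kerProj, cfc_mul_cfc, ← cfc_zero ℝ B]
  congr 1
  funext t
  by_cases ht : t = 0 <;> simp [ht, hf]

theorem kerProj_mul_of_suppLE {A B : Matrix n n ℂ} (hA : A.IsHermitian) (hB : B.IsHermitian)
    (hAB : SuppLE A B) : kerProj B * A = 0 := by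
  have h := congrArg Matrix.conjTranspose ((suppLE_iff hB).1 hAB)
  rwa [Matrix.conjTranspose_mul, hA.eq, (isHermitian_kerProj B).eq,
    Matrix.conjTranspose_zero] at h

omit [DecidableEq n] in
theorem suppLE_smul_self (r : ℝ) (B : Matrix n n ℂ) : SuppLE (r • B) B := fun v hv => by
  rw [Matrix.smul_mulVec, hv, smul_zero]

theorem trace_kerProj_mul_eq {A : Matrix n n ℂ} (B : Matrix n n ℂ) :
    (kerProj B * A).trace = ((kerProj B)ᴴ * A * kerProj B).trace := by
  rw [(isHermitian_kerProj B).eq, Matrix.trace_mul_comm _ (kerProj B), ← Matrix.mul_assoc,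
    kerProj_mul_self]

theorem trace_kerProj_mul_nonneg {A : Matrix n n ℂ} (hA : A.PosSemidef) (B : Matrix n n ℂ) :
    0 ≤ (kerProj B * A).trace.re := by
  rw [trace_kerProj_mul_eq]
  exact trace_re_nonneg (hA.conjTranspose_mul_mul_same _)

/-- The square root of `A`, as a function of `A`. -/
theorem exists_sqrt {A : Matrix n n ℂ} (hA : A.PosSemidef) :
    ∃ T : Matrix n n ℂ, T = A ^ (1 / 2 : ℝ) ∧ T.IsHermitian ∧ T * T = A := by
  refine ⟨_, rfl, (posSemidef_rpow A _).1, ?_⟩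
  rw [rpow_eq_cfc hA, cfc_mul_cfc]
  conv_rhs => rw [← cfc_id_of_isHermitian hA.1]
  refine cfc_congr_of_posSemidef hA fun t ht => ?_
  rw [← Real.sqrt_eq_rpow, Real.mul_self_sqrt ht]

/-- `Tr {K A}` is the squared Hilbert–Schmidt norm of `A ^ (1/2) K`. -/
theorem suppLE_of_trace_kerProj_mul {A B : Matrix n n ℂ} (hA : A.PosSemidef) (hB : B.IsHermitian)
    (h : (kerProj B * A).trace.re = 0) : SuppLE A B := by
  obtain ⟨T, -, hT, hTT⟩ := exists_sqrt hA
  rw [trace_kerProj_mul_eq, trace_re_eq_zero_iff (hA.conjTranspose_mul_mul_same _)] at h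
  have h' : (T * kerProj B)ᴴ * (T * kerProj B) = 0 := by
    rw [← h, ← hTT, Matrix.conjTranspose_mul, hT.eq]
    simp only [Matrix.mul_assoc]
  rw [Matrix.conjTranspose_mul_self_eq_zero] at h'
  rw [suppLE_iff hB, ← hTT, Matrix.mul_assoc, h', Matrix.mul_zero]

theorem rpow_mul_kerProj {B : Matrix n n ℂ} (hB : B.PosSemidef) {s : ℝ} (hs : s ≠ 0) :
    B ^ s * kerProj B = 0 := by
  rw [rpow_eq_cfc hB, cfc_mul_kerProj (f := fun t : ℝ => t ^ s) (Real.zero_rpow hs)]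

theorem kerProj_mul_rpow {B : Matrix n n ℂ} (hB : B.PosSemidef) {s : ℝ} (hs : s ≠ 0) :
    kerProj B * B ^ s = 0 := by
  rw [rpow_eq_cfc hB, kerProj_mul_cfc (f := fun t : ℝ => t ^ s) (Real.zero_rpow hs)]

theorem rpow_mul_rpow_neg {B : Matrix n n ℂ} (hB : B.PosSemidef) {s : ℝ} (hs : s ≠ 0) :
    B ^ s * B ^ (-s) = 1 - kerProj B := by
  rw [rpow_eq_cfc hB, rpow_eq_cfc hB, cfc_mul_cfc, one_sub_kerProj hB.1]
  refine cfc_congr_of_posSemidef hB fun t ht => ?_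
  rcases ht.eq_or_lt with rfl | ht
  · simp [hs]
  · rw [← Real.rpow_add ht, add_neg_cancel, Real.rpow_zero, if_neg ht.ne']

theorem rpow_neg_mul_rpow {B : Matrix n n ℂ} (hB : B.PosSemidef) {s : ℝ} (hs : s ≠ 0) :
    B ^ (-s) * B ^ s = 1 - kerProj B := by
  simpa using rpow_mul_rpow_neg hB (neg_ne_zero.2 hs)

theorem one_sub_kerProj_mul_mul {A B : Matrix n n ℂ} (hA : A.IsHermitian) (hB : B.IsHermitian)
    (hAB : SuppLE A B) : (1 - kerProj B) * A * (1 - kerProj B) = A := by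
  rw [Matrix.sub_mul, kerProj_mul_of_suppLE hA hB hAB, Matrix.one_mul, sub_zero, Matrix.mul_sub,
    (suppLE_iff hB).1 hAB, Matrix.mul_one, sub_zero]

/-- By cyclicity the powers of `B` combine to the projection onto its support, so exactly the weight
of `A` on `ker B` is lost. -/
theorem trace_sandwich_mul {A B : Matrix n n ℂ} (hB : B.PosSemidef) {s : ℝ} (hs : s ≠ 0) :
    (B ^ s * A * B ^ s * B ^ (-(2 * s))).trace.re = A.trace.re - (kerProj B * A).trace.re := by
  have h : B ^ s * B ^ (-(2 * s)) * B ^ s = 1 - kerProj B := by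
    rw [rpow_eq_cfc hB, rpow_eq_cfc hB, cfc_mul_cfc, cfc_mul_cfc, one_sub_kerProj hB.1]
    refine cfc_congr_of_posSemidef hB fun t ht => ?_
    rcases ht.eq_or_lt with rfl | ht
    · simp [hs]
    · rw [← Real.rpow_add ht, ← Real.rpow_add ht, if_neg ht.ne']
      ring_nf
      simp
  rw [Matrix.mul_assoc, Matrix.mul_assoc, Matrix.trace_mul_comm, Matrix.mul_assoc, h,
    Matrix.trace_mul_comm, Matrix.sub_mul, Matrix.one_mul, Matrix.trace_sub, Complex.sub_re]

end Support

/-! ### Sandwiched, geometric and Belavkin–Staszewski bounds. -/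

section Gap

variable {n : Type*} [Fintype n] [DecidableEq n]

/-- On the support the sandwich is undone by `B ^ (-s)`. The inclusion must be kept as a conjunct,
since the sandwich erases the part of `A` on `ker B`. -/
theorem sandwich_eq_iff {A B : Matrix n n ℂ} (hA : A.IsHermitian) (hB : B.PosSemidef) {α c : ℝ}
    (hα : 0 < α) (hs : (1 - α) / (2 * α) ≠ 0) :
    (B ^ ((1 - α) / (2 * α)) * A * B ^ ((1 - α) / (2 * α)) = c • B ^ (1 / α) ∧ SuppLE A B) ↔
      A = c • B := by
  obtain ⟨s, hsdef⟩ : ∃ s, s = (1 - α) / (2 * α) := ⟨_, rfl⟩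
  rw [← hsdef] at hs ⊢
  have hexp : 1 / α = s + 1 + s := by
    rw [hsdef]
    field_simp
    ring
  constructor
  · rintro ⟨h, hAB⟩
    have h1 : B ^ (-s) * (B ^ s * A * B ^ s) * B ^ (-s) = A := by
      conv_rhs => rw [← one_sub_kerProj_mul_mul hA hB.1 hAB]
      simp only [Matrix.mul_assoc]
      rw [rpow_mul_rpow_neg hB hs, ← Matrix.mul_assoc (B ^ (-s)), rpow_neg_mul_rpow hB hs]
    have h2 : B ^ (-s) * B ^ (1 / α) * B ^ (-s) = B := by
      rw [rpow_eq_cfc hB, rpow_eq_cfc hB, cfc_mul_cfc, cfc_mul_cfc]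
      conv_rhs => rw [← cfc_id_of_isHermitian hB.1]
      refine cfc_congr_of_posSemidef hB fun t ht => ?_
      rcases ht.eq_or_lt with rfl | ht
      · simp [hs]
      · rw [← Real.rpow_add ht, ← Real.rpow_add ht, hexp]
        ring_nf
        simp
    rw [← h1, h, Matrix.mul_smul, Matrix.smul_mul, h2]
  · rintro rfl
    refine ⟨?_, suppLE_smul_self c B⟩
    rw [Matrix.mul_smul, Matrix.smul_mul]
    congr 1
    rw [rpow_eq_cfc hB, rpow_eq_cfc hB, cfc_mul_self _ hB.1, cfc_mul_cfc]
    refine cfc_congr_of_posSemidef hB fun t ht => ?_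
    rcases ht.eq_or_lt with rfl | ht
    · simp [hα.ne']
    · rw [hexp, Real.rpow_add ht, Real.rpow_add ht, Real.rpow_one]

/-- Klein's inequality is applied to `W = B ^ s A B ^ s` and `B`, for which the support inclusion is
automatic. Its linear term sees `Tr A - Tr {K A}` instead of `Tr A`, so the gap gains a multiple of
`(1 - α) Tr {K A}`. -/
theorem sandwiched_gap {α : ℝ} (hα : 0 < α) (hα1 : α ≠ 1) {A B : Matrix n n ℂ}
    (hA : A.PosSemidef) (hB : B.PosSemidef) (hb : 0 < B.trace.re) (hAB : α < 1 ∨ SuppLE A B) :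
    RenyiGap α ((B ^ ((1 - α) / (2 * α)) * A * B ^ ((1 - α) / (2 * α))) ^ α).trace.re A B := by
  have hs : (1 - α) / (2 * α) ≠ 0 :=
    div_ne_zero (sub_ne_zero.2 hα1.symm) (mul_ne_zero two_ne_zero hα.ne')
  have hiff := fun c => sandwich_eq_iff (c := c) hA.1 hB hα hs
  have htrW := trace_sandwich_mul (A := A) hB hs
  have hBs := (posSemidef_rpow B ((1 - α) / (2 * α))).1
  have hW : (B ^ ((1 - α) / (2 * α)) * A * B ^ ((1 - α) / (2 * α))).PosSemidef := by
    have := hA.mul_mul_conjTranspose_same (B ^ ((1 - α) / (2 * α)))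
    rwa [hBs.eq] at this
  have hWB : SuppLE (B ^ ((1 - α) / (2 * α)) * A * B ^ ((1 - α) / (2 * α))) B := by
    rw [suppLE_iff hB.1, Matrix.mul_assoc, rpow_mul_kerProj hB hs, Matrix.mul_zero]
  rcases (trace_re_nonneg hA).eq_or_lt with ha | ha
  · rw [(trace_re_eq_zero_iff hA).1 ha.symm, Matrix.mul_zero, Matrix.zero_mul,
      rpow_eq_cfc PosSemidef.zero]
    simpa [Real.zero_rpow hα.ne'] using renyiGap_zero hα B
  generalize B ^ ((1 - α) / (2 * α)) * A * B ^ ((1 - α) / (2 * α)) = W at *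
  obtain ⟨c, hc⟩ : ∃ c, c = A.trace.re / B.trace.re := ⟨_, rfl⟩
  have hc0 : 0 < c := hc ▸ div_pos ha hb
  refine renyiGap_of_tangent hα1 ha hb hc ?_
  have hsum : ∀ x y : ℝ, ∑ k, (![fun t => t ^ α, fun t => t, fun _ => 1] :
      Fin 3 → ℝ → ℝ) k x * (![fun _ => (α - 1) * 1,
        fun t => -(α - 1) * (α * c ^ (α - 1)) * t ^ ((α - 1) / α),
        fun t => -(α - 1) * ((1 - α) * c ^ α) * t] :
      Fin 3 → ℝ → ℝ) k y = (α - 1) *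
        (x ^ α - (α * c ^ (α - 1) * (x * y ^ ((α - 1) / α)) + (1 - α) * c ^ α * y)) :=
    fun x y => by
      simp [Fin.sum_univ_three]
      ring
  have key := klein_eq_cfc hW hB _ _ (fun y => c * y ^ (1 / α)) True (fun _ => hWB)
    (fun x y hx hy hxy => by
      rw [hsum]
      exact rpow_sandwich_gap hα hα1 hc0 hx hy (hxy trivial))
  have hexp : -(2 * ((1 - α) / (2 * α))) = (α - 1) / α := by
    field_simp
    ring
  rw [hexp] at htrW
  rw [rpow_eq_cfc hW]
  simp only [Fin.sum_univ_three, Matrix.cons_val_zero, Matrix.cons_val_one, Matrix.cons_val] at key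
  simp only [cfc_smul_const, cfc_id_of_isHermitian hW.1, cfc_smul_id _ hB.1,
    cfc_one_of_isHermitian hW.1, cfc_one_of_isHermitian hB.1,
    Matrix.mul_smul, Matrix.mul_one, Matrix.one_mul, trace_re_smul, ← rpow_eq_cfc hB,
    htrW] at key
  have hk : 0 < α * c ^ (α - 1) := mul_pos hα (Real.rpow_pos_of_pos hc0 _)
  have hK := trace_kerProj_mul_nonneg hA B
  have hform : (α - 1) * ((cfc (fun t : ℝ => t ^ α) W).trace.re -
        (α * c ^ (α - 1) * A.trace.re + (1 - α) * c ^ α * B.trace.re)) =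
      ((α - 1) * (cfc (fun t : ℝ => t ^ α) W).trace.re +
        -(α - 1) * (α * c ^ (α - 1)) * (A.trace.re - (kerProj B * A).trace.re) +
        -(α - 1) * ((1 - α) * c ^ α) * B.trace.re) +
      (1 - α) * (kerProj B * A).trace.re * (α * c ^ (α - 1)) := by ring
  -- The extra term is never negative: it vanishes under support inclusion, and otherwise `α < 1`.
  -- It supplies the inclusion needed in the equality case.
  have hdef : 0 ≤ (1 - α) * (kerProj B * A).trace.re ∧
      ((1 - α) * (kerProj B * A).trace.re = 0 ↔ SuppLE A B) := by
    by_cases hsupp : SuppLE A B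
    · simp [kerProj_mul_of_suppLE hA.1 hB.1 hsupp, hsupp]
    · have hlt : 0 < 1 - α := sub_pos.2 (hAB.resolve_right hsupp)
      refine ⟨mul_nonneg hlt.le hK, fun h => ?_, fun h => absurd h hsupp⟩
      exact suppLE_of_trace_kerProj_mul hA hB.1 ((mul_eq_zero.1 h).resolve_left hlt.ne')
  rw [hform]
  refine ⟨add_nonneg key.1 (mul_nonneg hdef.1 hk.le), ?_⟩
  rw [add_eq_zero_iff_of_nonneg key.1 (mul_nonneg hdef.1 hk.le), key.2, mul_eq_zero,
    or_iff_left hk.ne', hdef.2, hiff]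

/-- Tangent bounds for `Tr {B φ(X)}`. -/
theorem trace_mul_cfc_gap {X B S : Matrix n n ℂ} (hX : X.PosSemidef) (hB : B.PosSemidef)
    (hS : S.IsHermitian) (hSS : S * S = B) {φ : ℝ → ℝ} {c u v : ℝ}
    (hφ : ∀ t, 0 ≤ t → 0 ≤ φ t - (u * t + v) ∧ (φ t - (u * t + v) = 0 ↔ t = c)) :
    0 ≤ (B * cfc φ X).trace.re - (u * (B * X).trace.re + v * B.trace.re) ∧
      ((B * cfc φ X).trace.re - (u * (B * X).trace.re + v * B.trace.re) = 0 ↔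
        S * X = c • S) := by
  have hsum : ∀ x y : ℝ, ∑ k, (![φ, fun t => t, fun _ => 1] : Fin 3 → ℝ → ℝ) k x *
      (![fun t => t, fun t => -u * t, fun t => -v * t] : Fin 3 → ℝ → ℝ) k y =
        y * (φ x - (u * x + v)) := fun x y => by
    simp [Fin.sum_univ_three]
    ring
  -- At `y = 0` the eigenvalue `x` is unconstrained, so the comparison function carries the factor
  -- `y`; its trace is the squared norm of `S (X - c)`.
  have hsq : ∀ x y : ℝ, ∑ k, (![fun t => t * t, fun t => t, fun _ => 1] : Fin 3 → ℝ → ℝ) k x *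
      (![fun t => t, fun t => -2 * c * t, fun t => c * c * t] : Fin 3 → ℝ → ℝ) k y =
        y * ((x - c) * (x - c)) := fun x y => by
    simp [Fin.sum_univ_three]
    ring
  have key := klein hX hB _ _ _ _ False False.elim
    (fun x y hx hy _ => (hsum x y).symm ▸ mul_nonneg hy (hφ x hx).1)
    (fun x y _ hy => (hsq x y).symm ▸ mul_nonneg hy (mul_self_nonneg _))
    (fun x y hx hy _ => by
      rw [hsum, hsq, mul_eq_zero, mul_eq_zero, (hφ x hx).2, mul_self_eq_zero, sub_eq_zero])
  simp only [Fin.sum_univ_three, Matrix.cons_val_zero, Matrix.cons_val_one, Matrix.cons_val] at key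
  simp only [cfc_id_of_isHermitian hX.1, cfc_smul_id _ hB.1, cfc_id_of_isHermitian hB.1,
    cfc_one_of_isHermitian hX.1, ← mul_cfc_self (fun t : ℝ => t) hX.1,
    Matrix.mul_smul, Matrix.one_mul, trace_re_smul] at key
  have htr : (X * X * B).trace.re + -2 * c * (X * B).trace.re + c * c * B.trace.re =
      ((S * X - c • S)ᴴ * (S * X - c • S)).trace.re := by
    have e1 : (X * S * (S * X)).trace = (X * X * B).trace := by
      rw [Matrix.trace_mul_comm, Matrix.mul_assoc, Matrix.trace_mul_comm]
      simp only [Matrix.mul_assoc, hSS]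
    have e2 : (S * (S * X)).trace = (X * B).trace := by
      rw [← Matrix.mul_assoc, hSS, Matrix.trace_mul_comm]
    rw [Matrix.conjTranspose_sub, Matrix.conjTranspose_smul, Matrix.conjTranspose_mul, hS.eq,
      hX.1.eq, star_trivial, Matrix.sub_mul, Matrix.mul_sub, Matrix.mul_sub, Matrix.mul_smul,
      Matrix.smul_mul, Matrix.smul_mul, Matrix.mul_smul, Matrix.mul_assoc X S S, hSS]
    simp only [Matrix.trace_sub, Complex.sub_re, trace_re_smul, e1, e2]
    ring
  rw [htr, trace_re_eq_zero_iff (posSemidef_conjTranspose_mul_self _),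
    Matrix.conjTranspose_mul_self_eq_zero, sub_eq_zero, Matrix.trace_mul_comm (cfc φ X) B,
    Matrix.trace_mul_comm X B] at key
  convert key using 2 <;> ring_nf

theorem posSemidef_sandwich {A : Matrix n n ℂ} (hA : A.PosSemidef) (B : Matrix n n ℂ) (s : ℝ) :
    (B ^ s * A * B ^ s).PosSemidef := by
  have := hA.mul_mul_conjTranspose_same (B ^ s)
  rwa [(posSemidef_rpow B s).1.eq] at this

theorem neg_half_eq : (-1 / 2 : ℝ) = -(1 / 2) := by norm_num

theorem trace_mul_geometric {A B : Matrix n n ℂ} (hB : B.PosSemidef) :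
    (B * (B ^ (-1 / 2 : ℝ) * A * B ^ (-1 / 2 : ℝ))).trace.re =
      A.trace.re - (kerProj B * A).trace.re := by
  rw [← trace_sandwich_mul (A := A) hB (s := -1 / 2) (by norm_num), Matrix.trace_mul_comm]
  norm_num
  rw [CFC.rpow_one B (nonneg_iff_posSemidef.2 hB)]

/-- Right multiplication by `B ^ (1/2)` recovers `A`, because `A` lives on the support of `B`. -/
theorem rpow_half_mul_geometric_eq_iff {A B : Matrix n n ℂ} (hA : A.IsHermitian)
    (hB : B.PosSemidef) (hAB : SuppLE A B) {c : ℝ} :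
    B ^ (1 / 2 : ℝ) * (B ^ (-1 / 2 : ℝ) * A * B ^ (-1 / 2 : ℝ)) = c • B ^ (1 / 2 : ℝ) ↔
      A = c • B := by
  obtain ⟨S, hS, hSh, hSS⟩ := exists_sqrt hB
  have hSR := rpow_mul_rpow_neg hB (s := 1 / 2) (by norm_num)
  have hRS := rpow_neg_mul_rpow hB (s := 1 / 2) (by norm_num)
  have hKS : kerProj B * S = 0 := hS ▸ kerProj_mul_rpow hB (by norm_num)
  have hSK : S * kerProj B = 0 := hS ▸ rpow_mul_kerProj hB (by norm_num)
  rw [neg_half_eq]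
  rw [← hS] at hSR hRS ⊢
  generalize B ^ (-(1 / 2) : ℝ) = R at *
  constructor
  · intro h
    have h1 : S * (R * A * R) * S = A := by
      conv_rhs => rw [← one_sub_kerProj_mul_mul hA hB.1 hAB]
      simp only [Matrix.mul_assoc, hRS]
      rw [← Matrix.mul_assoc S, hSR]
    rw [← h1, h, Matrix.smul_mul, hSS]
  · rintro rfl
    rw [Matrix.mul_smul, Matrix.smul_mul, Matrix.mul_smul]
    congr 1
    have : S * (R * B * R) = S * R * (S * (S * R)) := by
      rw [← hSS]
      simp only [Matrix.mul_assoc]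
    rw [this, hSR, Matrix.mul_sub S, hSK, Matrix.mul_one, sub_zero, Matrix.sub_mul, hKS,
      Matrix.one_mul, sub_zero]

theorem geometric_gap {α : ℝ} (hα : 0 < α) (hα1 : α ≠ 1) {A B : Matrix n n ℂ}
    (hA : A.PosSemidef) (hB : B.PosSemidef) (hb : 0 < B.trace.re) (hAB : SuppLE A B) :
    RenyiGap α (geometricTrace α A B) A B := by
  have hX := posSemidef_sandwich hA B (-1 / 2)
  obtain ⟨S, hS, hSh, hSS⟩ := exists_sqrt hB
  rw [geometricTrace, rpow_eq_cfc hX]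
  rcases (trace_re_nonneg hA).eq_or_lt with ha | ha
  · rw [(trace_re_eq_zero_iff hA).1 ha.symm]
    simpa [Real.zero_rpow hα.ne'] using renyiGap_zero hα B
  obtain ⟨c, hc⟩ : ∃ c, c = A.trace.re / B.trace.re := ⟨_, rfl⟩
  have hc0 : 0 < c := hc ▸ div_pos ha hb
  refine renyiGap_of_tangent hα1 ha hb hc ?_
  have key := trace_mul_cfc_gap hX hB hSh hSS (φ := fun t => (α - 1) * t ^ α)
    (u := (α - 1) * (α * c ^ (α - 1))) (v := (α - 1) * ((1 - α) * c ^ α)) (c := c)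
    (fun t ht => by
      convert rpow_tangent_gap hα hα1 hc0 ht using 2 <;> ring_nf)
  rw [hS, rpow_half_mul_geometric_eq_iff hA.1 hB hAB, trace_mul_geometric hB,
    kerProj_mul_of_suppLE hA.1 hB.1 hAB, cfc_smul_const, Matrix.mul_smul, trace_re_smul] at key
  convert key using 2 <;>
  · simp only [Matrix.trace_zero, Complex.zero_re]
    ring_nf

theorem kerProj_mul_schurPart (A B : Matrix n n ℂ) : kerProj B * schurPart A B = 0 := by
  have h : kerProj B * (1 - kerProj B) = 0 := by
    rw [Matrix.mul_sub, kerProj_mul_self, Matrix.mul_one, sub_self]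
  simp only [schurPart, Matrix.mul_sub, ← Matrix.mul_assoc, h, Matrix.zero_mul, sub_zero]

/-- With `A = T T`, `K` the kernel projection and `G` the generalized inverse of `K A K = (T K)ᴴ (T
K)`, the matrix `R = 1 - T K G K T` is an orthogonal projection. Hence the Schur complement is `(R T
P)ᴴ (R T P)` with `P = 1 - K`. -/
theorem posSemidef_schurPart {A : Matrix n n ℂ} (hA : A.PosSemidef) (B : Matrix n n ℂ) :
    (schurPart A B).PosSemidef := by
  obtain ⟨T, -, hT, hTT⟩ := exists_sqrt hA
  have hK := isHermitian_kerProj B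
  rw [schurPart]
  generalize kerProj B = K at *
  have hY : (K * A * K).PosSemidef := by
    have := hA.conjTranspose_mul_mul_same K
    rwa [hK.eq] at this
  have hG := (posSemidef_rpow (K * A * K) (-1)).1
  -- This generalized-inverse identity is what makes `R` idempotent.
  have hGYG : (K * A * K) ^ (-1 : ℝ) * (K * A * K) * (K * A * K) ^ (-1 : ℝ) =
      (K * A * K) ^ (-1 : ℝ) := by
    rw [rpow_eq_cfc hY, cfc_mul_self _ hY.1, cfc_mul_cfc]
    refine cfc_congr_of_posSemidef hY fun t ht => ?_
    rcases ht.eq_or_lt with rfl | ht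
    · simp
    · simp [Real.rpow_neg_one, ht.ne']
  generalize (K * A * K) ^ (-1 : ℝ) = G at *
  have key : (1 - K) * A * (1 - K) - (1 - K) * A * K * G * (K * A * (1 - K)) =
      ((1 - T * K * G * K * T) * T * (1 - K))ᴴ * ((1 - T * K * G * K * T) * T * (1 - K)) := by
    have hR : (1 - T * K * G * K * T) * (1 - T * K * G * K * T) = 1 - T * K * G * K * T := by
      have : T * K * G * K * T * (T * K * G * K * T) = T * K * G * K * T := by
        calc _ = T * K * (G * (K * (T * T) * K) * G) * K * T := by simp only [Matrix.mul_assoc]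
          _ = _ := by rw [hTT, hGYG]
      rw [Matrix.mul_sub, Matrix.sub_mul _ _ (T * K * G * K * T), this]
      simp
    have hRh : (1 - T * K * G * K * T)ᴴ = 1 - T * K * G * K * T := by
      simp only [Matrix.conjTranspose_sub, Matrix.conjTranspose_mul, Matrix.conjTranspose_one,
        hT.eq, hK.eq, hG.eq, Matrix.mul_assoc]
    have hPh : (1 - K)ᴴ = 1 - K := by rw [Matrix.conjTranspose_sub, Matrix.conjTranspose_one, hK.eq]
    rw [Matrix.conjTranspose_mul, Matrix.conjTranspose_mul, hRh, hPh, hT.eq]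
    generalize 1 - K = P
    calc _ = P * T * (1 - T * K * G * K * T) * (T * P) := by
          rw [← hTT, Matrix.mul_sub, Matrix.sub_mul, Matrix.mul_one]
          simp only [Matrix.mul_assoc]
      _ = P * T * ((1 - T * K * G * K * T) * (1 - T * K * G * K * T)) * (T * P) := by rw [hR]
      _ = _ := by simp only [Matrix.mul_assoc]
  rw [key]
  exact posSemidef_conjTranspose_mul_self _

theorem trace_schurPart_le {A B : Matrix n n ℂ} (hA : A.IsHermitian) :
    (schurPart A B).trace.re ≤ A.trace.re - (kerProj B * A).trace.re := by
  have hK := isHermitian_kerProj B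
  have hKK := kerProj_mul_self B
  rw [schurPart]
  generalize kerProj B = K at *
  have h1 : ((1 - K) * A * (1 - K)).trace = A.trace - (K * A).trace := by
    rw [Matrix.trace_mul_comm, ← Matrix.mul_assoc, Matrix.mul_sub (1 - K) 1 K, Matrix.sub_mul 1 K K,
      hKK]
    simp [Matrix.sub_mul]
  have h2 : ((1 - K) * A * K * (K * A * K) ^ (-1 : ℝ) * (K * A * (1 - K))).PosSemidef := by
    have h := (posSemidef_rpow (K * A * K) (-1)).conjTranspose_mul_mul_same (K * A * (1 - K))
    have hZ : (K * A * (1 - K))ᴴ = (1 - K) * A * K := by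
      rw [Matrix.conjTranspose_mul, Matrix.conjTranspose_mul, Matrix.conjTranspose_sub,
        Matrix.conjTranspose_one, hK.eq, hA.eq, Matrix.mul_assoc]
    rwa [hZ] at h
  have h3 := trace_re_nonneg h2
  rw [Matrix.trace_sub, h1]
  simp only [Complex.sub_re]
  linarith

theorem schurPart_of_suppLE {A B : Matrix n n ℂ} (hA : A.IsHermitian) (hB : B.IsHermitian)
    (hAB : SuppLE A B) : schurPart A B = A := by
  rw [schurPart, one_sub_kerProj_mul_mul hA hB hAB, Matrix.mul_assoc (1 - kerProj B) A,
    (suppLE_iff hB).1 hAB]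
  simp

/-- Without support inclusion `Tr {K A} > 0`, so the Schur complement has strictly smaller trace
than `A`. The tangent has positive slope, hence the bound is strict; `A = c B` is impossible as
well. -/
theorem geometric_schurPart_gap {α : ℝ} (hα : 0 < α) (hα1 : α < 1) {A B : Matrix n n ℂ}
    (hA : A.PosSemidef) (hB : B.PosSemidef) (hb : 0 < B.trace.re) :
    RenyiGap α (geometricTrace α (schurPart A B) B) A B := by
  by_cases hAB : SuppLE A B
  · rw [schurPart_of_suppLE hA.1 hB.1 hAB]
    exact geometric_gap hα hα1.ne hA hB hb hAB
  have hA' := posSemidef_schurPart hA B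
  have hX := posSemidef_sandwich hA' B (-1 / 2)
  obtain ⟨S, hS, hSh, hSS⟩ := exists_sqrt hB
  rw [geometricTrace, rpow_eq_cfc hX]
  rcases (trace_re_nonneg hA).eq_or_lt with ha | ha
  · refine absurd (fun v _ => ?_) hAB
    rw [(trace_re_eq_zero_iff hA).1 ha.symm, Matrix.zero_mulVec]
  obtain ⟨c, hc⟩ : ∃ c, c = A.trace.re / B.trace.re := ⟨_, rfl⟩
  have hc0 : 0 < c := hc ▸ div_pos ha hb
  refine renyiGap_of_tangent hα1.ne ha hb hc ?_
  have key := (trace_mul_cfc_gap hX hB hSh hSS (φ := fun t => (α - 1) * t ^ α)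
    (u := (α - 1) * (α * c ^ (α - 1))) (v := (α - 1) * ((1 - α) * c ^ α)) (c := c)
    (fun t ht => by
      convert rpow_tangent_gap hα hα1.ne hc0 ht using 2 <;> ring_nf)).1
  rw [trace_mul_geometric hB, kerProj_mul_schurPart, Matrix.trace_zero, Complex.zero_re, sub_zero,
    cfc_smul_const, Matrix.mul_smul, trace_re_smul] at key
  have hk : 0 < (1 - α) * (α * c ^ (α - 1)) :=
    mul_pos (sub_pos.2 hα1) (mul_pos hα (Real.rpow_pos_of_pos hc0 _))
  have hK : 0 < (kerProj B * A).trace.re :=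
    (trace_kerProj_mul_nonneg hA B).lt_of_ne'
      fun h => hAB (suppLE_of_trace_kerProj_mul hA hB.1 h)
  have hlt : (schurPart A B).trace.re < A.trace.re := by
    linarith [trace_schurPart_le (B := B) hA.1]
  have hpos := mul_lt_mul_of_pos_left hlt hk
  have hne : A ≠ c • B := by
    rintro rfl
    exact hAB (suppLE_smul_self c B)
  generalize (B * cfc (fun t : ℝ => t ^ α) _).trace.re = q at *
  have hgap : 0 < (α - 1) *
      (q - (α * c ^ (α - 1) * A.trace.re + (1 - α) * c ^ α * B.trace.re)) := by
    linear_combination hpos + key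
  exact ⟨hgap.le, fun h => absurd h hgap.ne', fun h => absurd h hne⟩

/-- Put `Z = B ^ (-1/2) A ^ (1/2)`. The two arguments of the calculus are `Zᴴ Z` and `Z Zᴴ`,
intertwined by `Z`, and `B ^ (1/2) Z = A ^ (1/2)` by support inclusion. The divergence thus takes
the form `Tr {B φ(X)}` with `φ(t) = t log₂ t`. -/
theorem belavkinStaszewski_trace_eq {A B : Matrix n n ℂ} (hA : A.PosSemidef) (hB : B.PosSemidef)
    (hAB : SuppLE A B) :
    (A * log2 (A ^ (1 / 2 : ℝ) * B ^ (-1 : ℝ) * A ^ (1 / 2 : ℝ))).trace =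
      (B * cfc (fun t => t * Real.logb 2 t) (B ^ (-1 / 2 : ℝ) * A * B ^ (-1 / 2 : ℝ))).trace := by
  have hX := posSemidef_sandwich hA B (-1 / 2)
  obtain ⟨T, hT, hTh, hTT⟩ := exists_sqrt hA
  obtain ⟨S, hS, hSh, hSS⟩ := exists_sqrt hB
  have hSR := rpow_mul_rpow_neg hB (s := 1 / 2) (by norm_num)
  have hRh := (posSemidef_rpow B (-(1 / 2))).1
  have hRR : B ^ (-(1 / 2) : ℝ) * B ^ (-(1 / 2) : ℝ) = B ^ (-1 : ℝ) := by
    rw [rpow_eq_cfc hB, rpow_eq_cfc hB, cfc_mul_cfc]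
    refine cfc_congr_of_posSemidef hB fun t ht => ?_
    rcases ht.eq_or_lt with rfl | ht
    · simp
    · rw [← Real.rpow_add ht]
      norm_num
  have hKT : kerProj B * T = 0 := by
    have h1 := (suppLE_iff hB.1).1 hAB
    have h2 : (T * kerProj B)ᴴ * (T * kerProj B) = 0 := by
      rw [Matrix.conjTranspose_mul, hTh.eq, Matrix.mul_assoc, ← Matrix.mul_assoc T, hTT, h1,
        Matrix.mul_zero]
    rw [Matrix.conjTranspose_mul_self_eq_zero] at h2
    have h3 := congrArg Matrix.conjTranspose h2
    rwa [Matrix.conjTranspose_mul, hTh.eq, (isHermitian_kerProj B).eq,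
      Matrix.conjTranspose_zero] at h3
  rw [neg_half_eq] at hX ⊢
  rw [← hT, ← hRR, log2, ← mul_cfc_self _ hX.1]
  rw [← hS] at hSR
  generalize B ^ (-(1 / 2) : ℝ) = R at *
  have hSRT : S * (R * T) = T := by
    rw [← Matrix.mul_assoc, hSR, Matrix.sub_mul, hKT, Matrix.one_mul, sub_zero]
  have hZ : (R * T)ᴴ = T * R := by rw [Matrix.conjTranspose_mul, hTh.eq, hRh.eq]
  have hTRS : T * R * S = T := by
    have := congrArg Matrix.conjTranspose hSRT
    rwa [Matrix.conjTranspose_mul, hZ, hTh.eq, hSh.eq] at this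
  have h1 : T * (R * R) * T = (R * T)ᴴ * (R * T) := by
    rw [hZ]
    simp only [Matrix.mul_assoc]
  have h2 : R * A * R = (R * T) * (R * T)ᴴ := by
    rw [hZ, ← hTT]
    simp only [Matrix.mul_assoc]
  have h3 := mul_cfc_conjTranspose_mul_self (Real.logb 2) (R * T)
  rw [← h1, ← h2] at h3
  have h4 : R * A * R * cfc (Real.logb 2) (R * A * R) =
      R * T * cfc (Real.logb 2) (T * (R * R) * T) * (T * R) := by
    rw [h3, Matrix.mul_assoc _ (R * T), ← hZ, ← h2, mul_cfc_self _ hX.1, cfc_mul_self _ hX.1]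
    simp only [mul_comm]
  rw [h4, ← hSS, Matrix.mul_assoc S S, Matrix.trace_mul_comm S, ← hTT, Matrix.mul_assoc T T,
    Matrix.trace_mul_comm T]
  congr 1
  calc T * cfc (Real.logb 2) (T * (R * R) * T) * T
      = (S * (R * T)) * cfc (Real.logb 2) (T * (R * R) * T) * (T * R * S) := by
        rw [hSRT, hTRS]
    _ = _ := by simp only [Matrix.mul_assoc]

theorem belavkinStaszewski_gap {A B : Matrix n n ℂ} (hA : A.PosSemidef) (hB : B.PosSemidef)
    (hb : 0 < B.trace.re) (hAB : SuppLE A B) :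
    EntropyGap (A * log2 (A ^ (1 / 2 : ℝ) * B ^ (-1 : ℝ) * A ^ (1 / 2 : ℝ))).trace.re A B := by
  rcases (trace_re_nonneg hA).eq_or_lt with ha | ha
  · rw [(trace_re_eq_zero_iff hA).1 ha.symm]
    simpa using entropyGap_zero B
  rw [belavkinStaszewski_trace_eq hA hB hAB]
  have hX := posSemidef_sandwich hA B (-1 / 2)
  obtain ⟨S, hS, hSh, hSS⟩ := exists_sqrt hB
  obtain ⟨c, hc⟩ : ∃ c, c = A.trace.re / B.trace.re := ⟨_, rfl⟩
  have hc0 : 0 < c := hc ▸ div_pos ha hb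
  refine entropyGap_of_tangent hb hc ?_
  have key := trace_mul_cfc_gap hX hB hSh hSS (φ := fun t => t * Real.logb 2 t)
    (u := Real.logb 2 c + 1 / Real.log 2) (v := -(c / Real.log 2)) (c := c)
    (fun t ht => by
      convert mul_logb_tangent_gap hc0 ht using 2 <;> ring_nf)
  rw [hS, rpow_half_mul_geometric_eq_iff hA.1 hB hAB, trace_mul_geometric hB,
    kerProj_mul_of_suppLE hA.1 hB.1 hAB] at key
  convert key using 2 <;>
  · simp only [Matrix.trace_zero, Complex.zero_re]
    ring_nf

end Gap

/-! ### Transport along star homomorphisms from block families. -/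

section BlockDiagonal

variable {X Q N : Type*} [Fintype X] [Fintype Q] [DecidableEq Q] [Fintype N] [DecidableEq N]
  (φ : (X → Matrix Q Q ℂ) →⋆ₐ[ℝ] Matrix N N ℂ) {A B : X → Matrix Q Q ℂ}

omit [Fintype X] in
theorem isHermitian_map (hA : ∀ x, (A x).IsHermitian) : (φ A).IsHermitian := by
  have : star A = A := funext fun x => hA x
  rw [Matrix.IsHermitian, ← Matrix.star_eq_conjTranspose, ← map_star, this]

/-- A single polynomial interpolates `f` on the spectra of all blocks and of the image, and algebra
homomorphisms commute with polynomials. -/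
theorem map_cfc (f : ℝ → ℝ) (hA : ∀ x, (A x).IsHermitian) :
    φ (fun x => cfc f (A x)) = cfc f (φ A) := by
  obtain ⟨q, hq⟩ := exists_polynomial_eval_eq
    ((Set.finite_iUnion fun x => Matrix.finite_real_spectrum (A := A x)).union
      (Matrix.finite_real_spectrum (A := φ A))) f
  rw [cfc_eq_aeval (isHermitian_map φ hA) fun t ht => hq t (.inr ht)]
  have h : (fun x => cfc f (A x)) = Polynomial.aeval A q := by
    funext x
    rw [Polynomial.aeval_pi_apply₂,
      cfc_eq_aeval (hA x) fun t ht => hq t (.inl (Set.mem_iUnion.2 ⟨x, ht⟩))]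
  rw [h]
  exact (Polynomial.aeval_algHom_apply (φ : (X → Matrix Q Q ℂ) →ₐ[ℝ] Matrix N N ℂ) A q).symm

omit [Fintype X] in
theorem posSemidef_map (hA : ∀ x, (A x).PosSemidef) : (φ A).PosSemidef := by
  choose T _ hT hTT using fun x => exists_sqrt (hA x)
  have h : A = T * T := funext fun x => (hTT x).symm
  have := posSemidef_conjTranspose_mul_self (φ T)
  rwa [(isHermitian_map φ hT).eq, ← map_mul, ← h] at this

theorem map_rpow (hA : ∀ x, (A x).PosSemidef) (s : ℝ) : φ (fun x => A x ^ s) = φ A ^ s := by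
  rw [rpow_eq_cfc (posSemidef_map φ hA), ← map_cfc φ _ fun x => (hA x).1]
  simp only [rpow_eq_cfc (hA _)]

theorem map_kerProj (hB : ∀ x, (B x).IsHermitian) :
    φ (fun x => kerProj (B x)) = kerProj (φ B) :=
  map_cfc φ _ hB

theorem suppLE_map_iff (hφ : Function.Injective φ) (hB : ∀ x, (B x).IsHermitian) :
    SuppLE (φ A) (φ B) ↔ ∀ x, SuppLE (A x) (B x) := by
  rw [suppLE_iff (isHermitian_map φ hB), ← map_kerProj φ hB, ← map_mul,
    map_eq_zero_iff φ hφ, funext_iff]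
  exact forall_congr' fun x => (suppLE_iff (hB x)).symm

theorem map_sandwich (hB : ∀ x, (B x).PosSemidef) (s : ℝ) :
    φ (fun x => B x ^ s * A x * B x ^ s) = φ B ^ s * φ A * φ B ^ s := by
  rw [← map_rpow φ hB, ← map_mul, ← map_mul]
  rfl

theorem map_schurPart (hA : ∀ x, (A x).PosSemidef) (hB : ∀ x, (B x).IsHermitian) :
    φ (fun x => schurPart (A x) (B x)) = schurPart (φ A) (φ B) := by
  have hY : ∀ x, (kerProj (B x) * A x * kerProj (B x)).PosSemidef := fun x => by
    have := (hA x).conjTranspose_mul_mul_same (kerProj (B x))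
    rwa [(isHermitian_kerProj (B x)).eq] at this
  have hG : φ (fun x => (kerProj (B x) * A x * kerProj (B x)) ^ (-1 : ℝ)) =
      (kerProj (φ B) * φ A * kerProj (φ B)) ^ (-1 : ℝ) := by
    rw [map_rpow φ hY, ← map_kerProj φ hB, ← map_mul, ← map_mul]
    rfl
  rw [schurPart, ← hG, ← map_kerProj φ hB, ← map_one φ]
  simp only [← map_mul, ← map_sub]
  rfl

theorem trace_re_map {S : X → Matrix Q Q ℂ} (h : (φ S).trace = ∑ x, (S x).trace) :
    (φ S).trace.re = ∑ x, (S x).trace.re := by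
  rw [h, Complex.re_sum]

theorem geometricTrace_map (htr : ∀ S, (φ S).trace = ∑ x, (S x).trace) (α : ℝ)
    (hA : ∀ x, (A x).PosSemidef) (hB : ∀ x, (B x).PosSemidef) :
    geometricTrace α (φ A) (φ B) = ∑ x, geometricTrace α (A x) (B x) := by
  rw [geometricTrace, ← map_sandwich φ hB,
    ← map_rpow φ fun x => posSemidef_sandwich (hA x) (B x) (-1 / 2), ← map_mul,
    trace_re_map φ (htr _)]
  rfl

end BlockDiagonal

/-! ### From block bounds to divergences. -/

section Eval

variable {X Q N : Type*} [Fintype X] [Fintype Q] [DecidableEq Q] [Fintype N] [DecidableEq N]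

theorem trace_re_mul_nonneg {A B : Matrix Q Q ℂ} (hA : A.PosSemidef) (hB : B.PosSemidef) :
    0 ≤ (A * B).trace.re := by
  obtain ⟨T, -, hT, hTT⟩ := exists_sqrt hA
  have h := trace_re_nonneg (hB.conjTranspose_mul_mul_same T)
  rwa [hT.eq, Matrix.trace_mul_comm, ← Matrix.mul_assoc, hTT] at h

omit [DecidableEq Q] in
-- The map `Q ↦ (α - 1)⁻¹ log₂ Q` increases for `α > 1` and decreases for `α < 1`, matching the sign
-- in the summed block gaps.
theorem renyiValue_sum_gap {α : ℝ} (hα1 : α ≠ 1) {A B : X → Matrix Q Q ℂ} {a b : X → ℝ}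
    (ha : ∀ x, (A x).trace.re = a x) (hb : ∀ x, (B x).trace.re = b x)
    (ha0 : ∀ x, 0 ≤ a x) (hb0 : ∀ x, 0 < b x) (ha1 : ∑ x, a x = 1)
    {q : X → ℝ} (hq : ∀ x, 0 ≤ q x) (hgap : ∀ x, RenyiGap α (q x) (A x) (B x)) :
    ((classicalRenyi α a b : ℝ) : EReal) ≤ renyiValue α (∑ x, q x) ∧
      (renyiValue α (∑ x, q x) = ((classicalRenyi α a b : ℝ) : EReal) ↔
        ∀ x, A x = (a x / b x) • B x) := by
  simp only [RenyiGap, ha, hb] at hgap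
  have hsum : 0 ≤ (α - 1) * (∑ x, q x - ∑ x, a x ^ α * b x ^ (1 - α)) ∧
      (∑ x, q x = ∑ x, a x ^ α * b x ^ (1 - α) ↔ ∀ x, A x = (a x / b x) • B x) := by
    rw [← Finset.sum_sub_distrib, Finset.mul_sum]
    refine ⟨Finset.sum_nonneg fun x _ => (hgap x).1, ?_⟩
    have h := Finset.sum_eq_zero_iff_of_nonneg (s := Finset.univ) fun x _ => (hgap x).1
    rw [← Finset.mul_sum, mul_eq_zero, or_iff_right (sub_ne_zero.2 hα1), Finset.sum_sub_distrib,
      sub_eq_zero] at h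
    rw [h]
    refine forall_congr' fun x => ?_
    rw [← (hgap x).2, mul_eq_zero, or_iff_right (sub_ne_zero.2 hα1), sub_eq_zero]
    simp
  -- A block of positive trace makes the classical sum positive, so a vanishing quantum sum, with
  -- value `+∞`, cannot be an equality case.
  obtain ⟨x₀, hx₀⟩ : ∃ x, 0 < a x := by
    by_contra! h
    have := Finset.sum_nonpos fun x (_ : x ∈ Finset.univ) => h x
    linarith
  have hQ0 : 0 < ∑ x, a x ^ α * b x ^ (1 - α) :=
    Finset.sum_pos' (fun x _ => mul_nonneg (Real.rpow_nonneg (ha0 x) _)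
        (Real.rpow_nonneg (hb0 x).le _))
      ⟨x₀, Finset.mem_univ _, mul_pos (Real.rpow_pos_of_pos hx₀ _)
        (Real.rpow_pos_of_pos (hb0 x₀) _)⟩
  have hQ := Finset.sum_nonneg fun x (_ : x ∈ Finset.univ) => hq x
  rw [← hsum.2, classicalRenyi, renyiValue]
  replace hsum := hsum.1
  generalize ∑ x, q x = Q at *
  generalize ∑ x, a x ^ α * b x ^ (1 - α) = Q0 at *
  rcases hQ.eq_or_lt with rfl | hQ
  · rw [if_pos rfl]
    exact ⟨le_top, fun h => absurd h.symm (EReal.coe_ne_top _), fun h => absurd h hQ0.ne⟩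
  · rw [if_neg hQ.ne', EReal.coe_le_coe_iff, EReal.coe_eq_coe_iff,
      mul_right_inj' (one_div_ne_zero (sub_ne_zero.2 hα1)),
      (Real.logb_injOn_pos one_lt_two).eq_iff hQ hQ0]
    refine ⟨?_, Iff.rfl⟩
    rcases lt_or_gt_of_ne hα1 with h | h
    · have h1 : Q ≤ Q0 := by nlinarith
      exact mul_le_mul_of_nonpos_left (Real.logb_le_logb_of_le one_lt_two hQ h1)
        (one_div_nonpos.2 (by linarith))
    · have h1 : Q0 ≤ Q := by nlinarith
      exact mul_le_mul_of_nonneg_left (Real.logb_le_logb_of_le one_lt_two hQ0 h1)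
        (one_div_nonneg.2 (by linarith))

omit [DecidableEq Q] in
theorem entropy_sum_gap {A B : X → Matrix Q Q ℂ} {a b : X → ℝ}
    (ha : ∀ x, (A x).trace.re = a x) (hb : ∀ x, (B x).trace.re = b x)
    {d : X → ℝ} (hgap : ∀ x, EntropyGap (d x) (A x) (B x)) :
    ((classicalKL a b : ℝ) : EReal) ≤ ((∑ x, d x : ℝ) : EReal) ∧
      (((∑ x, d x : ℝ) : EReal) = ((classicalKL a b : ℝ) : EReal) ↔
        ∀ x, A x = (a x / b x) • B x) := by
  simp only [EntropyGap, ha, hb] at hgap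
  have hle : ∀ x ∈ Finset.univ, a x * Real.logb 2 (a x / b x) ≤ d x := fun x _ =>
    sub_nonneg.1 (hgap x).1
  rw [EReal.coe_le_coe_iff, EReal.coe_eq_coe_iff, classicalKL]
  refine ⟨Finset.sum_le_sum hle, ?_⟩
  rw [eq_comm, Finset.sum_eq_sum_iff_of_le hle]
  refine forall_congr' fun x => ?_
  rw [← (hgap x).2, eq_comm]
  simp

/-- Every divergence of block-diagonal operators is at least the classical divergence of the block
traces, with equality exactly for blockwise proportional operators. -/
theorem eval_gap (φ : (X → Matrix Q Q ℂ) →⋆ₐ[ℝ] Matrix N N ℂ) (hφ : Function.Injective φ)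
    (htr : ∀ S, (φ S).trace = ∑ x, (S x).trace) {A B : X → Matrix Q Q ℂ}
    (hA : ∀ x, (A x).PosSemidef) (hB : ∀ x, (B x).PosSemidef) {a b : X → ℝ}
    (ha : ∀ x, (A x).trace.re = a x) (hb : ∀ x, (B x).trace.re = b x)
    (hb0 : ∀ x, 0 < b x) (ha1 : ∑ x, a x = 1) {𝔻 : Divergence} (h𝔻 : 𝔻.Admissible) :
    ((𝔻.classical a b : ℝ) : EReal) ≤ 𝔻.eval (φ A) (φ B) ∧
      (𝔻.eval (φ A) (φ B) = ((𝔻.classical a b : ℝ) : EReal) ↔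
        ∀ x, A x = (a x / b x) • B x) := by
  have ha0 : ∀ x, 0 ≤ a x := fun x => ha x ▸ trace_re_nonneg (hA x)
  have hb' : ∀ x, 0 < (B x).trace.re := fun x => (hb x).symm ▸ hb0 x
  have hsupp := suppLE_map_iff (A := A) φ hφ fun x => (hB x).1
  -- In the branches with value `+∞` equality fails on both sides: blockwise proportionality would
  -- force the support inclusion.
  have htop : ¬ SuppLE (φ A) (φ B) → ∀ r : ℝ, (r : EReal) ≤ ⊤ ∧
      ((⊤ : EReal) = (r : EReal) ↔ ∀ x, A x = (a x / b x) • B x) := fun h r => by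
    refine ⟨le_top, fun h' => absurd h'.symm (EReal.coe_ne_top r), fun h' => absurd ?_ h⟩
    rw [hsupp]
    intro x
    rw [h' x]
    exact suppLE_smul_self _ _
  cases 𝔻 with
  | umegaki =>
    simp only [Divergence.eval, Divergence.classical, umegaki]
    split_ifs with h
    · rw [log2, log2, ← map_cfc φ _ fun x => (hA x).1, ← map_cfc φ _ fun x => (hB x).1, ← map_sub,
        ← map_mul, trace_re_map φ (htr _)]
      exact entropy_sum_gap ha hb fun x => umegaki_gap (hA x) (hB x) (hb' x) (hsupp.1 h x)
    · exact htop h _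
  | petz α =>
    have hα : 0 < α ∧ α ≠ 1 := by
      rcases h𝔻 with h | h
      · exact ⟨h.1, h.2.ne⟩
      · exact ⟨one_pos.trans h.1, h.1.ne'⟩
    simp only [Divergence.eval, Divergence.classical, petzRenyi]
    split_ifs with h
    · rw [← map_rpow φ hA, ← map_rpow φ hB, ← map_mul, trace_re_map φ (htr _)]
      exact renyiValue_sum_gap hα.2 ha hb ha0 hb0 ha1
        (fun x => trace_re_mul_nonneg (posSemidef_rpow _ _) (posSemidef_rpow _ _))
        fun x => petz_gap hα.1 hα.2 (hA x) (hB x) (hb' x) (h.imp_right fun h => hsupp.1 h x)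
    · exact htop (not_or.1 h).2 _
  | sandwiched α =>
    have hα : 0 < α ∧ α ≠ 1 := by
      rcases h𝔻 with h | h
      · exact ⟨one_half_pos.trans_le h.1, h.2.ne⟩
      · exact ⟨one_pos.trans h, ne_of_gt h⟩
    simp only [Divergence.eval, Divergence.classical, sandwichedRenyi]
    split_ifs with h
    · rw [← map_sandwich φ hB, ← map_rpow φ fun x => posSemidef_sandwich (hA x) (B x) _,
        trace_re_map φ (htr _)]
      exact renyiValue_sum_gap hα.2 ha hb ha0 hb0 ha1
        (fun x => trace_re_nonneg (posSemidef_rpow _ _))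
        fun x => sandwiched_gap hα.1 hα.2 (hA x) (hB x) (hb' x) (h.imp_right fun h => hsupp.1 h x)
    · exact htop (not_or.1 h).2 _
  | geometric α =>
    have hα : 0 < α ∧ α ≠ 1 := by
      rcases h𝔻 with h | h
      · exact ⟨h.1, h.2.ne⟩
      · exact ⟨one_pos.trans h.1, h.1.ne'⟩
    simp only [Divergence.eval, Divergence.classical, geometricRenyi]
    split_ifs with h h'
    · rw [geometricTrace_map φ htr α hA hB]
      exact renyiValue_sum_gap hα.2 ha hb ha0 hb0 ha1
        (fun x => trace_re_mul_nonneg (hB x) (posSemidef_rpow _ _))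
        fun x => geometric_gap hα.1 hα.2 (hA x) (hB x) (hb' x) (hsupp.1 h x)
    · rw [← map_schurPart φ hA fun x => (hB x).1,
        geometricTrace_map φ htr α (fun x => posSemidef_schurPart (hA x) (B x)) hB]
      exact renyiValue_sum_gap hα.2 ha hb ha0 hb0 ha1
        (fun x => trace_re_mul_nonneg (hB x) (posSemidef_rpow _ _))
        fun x => geometric_schurPart_gap hα.1 h' (hA x) (hB x) (hb' x)
    · exact htop h _
  | belavkinStaszewski =>
    simp only [Divergence.eval, Divergence.classical, belavkinStaszewski]
    split_ifs with h
    · have hY : ∀ x, ((A x) ^ (1 / 2 : ℝ) * (B x) ^ (-1 : ℝ) * (A x) ^ (1 / 2 : ℝ)).PosSemidef :=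
        fun x => posSemidef_sandwich (posSemidef_rpow _ _) _ _
      have hmap : φ (fun x => (A x) ^ (1 / 2 : ℝ) * (B x) ^ (-1 : ℝ) * (A x) ^ (1 / 2 : ℝ)) =
          φ A ^ (1 / 2 : ℝ) * φ B ^ (-1 : ℝ) * φ A ^ (1 / 2 : ℝ) := by
        rw [map_sandwich φ hA, map_rpow φ hB]
      rw [log2, ← hmap, ← map_cfc φ _ fun x => (hY x).1, ← map_mul, trace_re_map φ (htr _)]
      exact entropy_sum_gap ha hb fun x =>
        belavkinStaszewski_gap (hA x) (hB x) (hb' x) (hsupp.1 h x)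
    · exact htop h _

end Eval

/-! ### Classical-quantum and classical states. -/

section States

variable {X Q : Type*} [Fintype X] [DecidableEq X] [Fintype Q] [DecidableEq Q]

omit [Fintype Q] [DecidableEq Q] in
theorem cqMatrix_apply (S : X → Matrix Q Q ℂ) (p r : X × Q) :
    cqMatrix S p r = if p.1 = r.1 then S p.1 p.2 r.2 else 0 := by
  simp only [cqMatrix, Matrix.sum_apply, Matrix.kroneckerMap_apply, Matrix.single_apply]
  rw [Finset.sum_eq_single p.1]
  · simp
  · intro x _ hx
    simp [hx]
  · simp

/-- Block-diagonal matrices as a star algebra. -/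
def cqHom (X Q : Type*) [Fintype X] [DecidableEq X] [Fintype Q] [DecidableEq Q] :
    (X → Matrix Q Q ℂ) →⋆ₐ[ℝ] Matrix (X × Q) (X × Q) ℂ where
  toFun := cqMatrix
  map_one' := by
    ext ⟨x, q⟩ ⟨y, r⟩
    simp only [cqMatrix_apply, Pi.one_apply, Matrix.one_apply, Prod.mk.injEq]
    split_ifs <;> simp_all
  map_mul' S T := by
    ext ⟨x, q⟩ ⟨y, r⟩
    simp only [cqMatrix_apply, Matrix.mul_apply, Fintype.sum_prod_type, Pi.mul_apply]
    rw [Finset.sum_eq_single x]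
    · by_cases h : x = y <;> simp [h]
    · intro z _ hz
      simp [hz.symm]
    · simp
  map_zero' := by
    ext
    simp [cqMatrix_apply]
  map_add' S T := by
    ext
    simp only [cqMatrix_apply, Matrix.add_apply, Pi.add_apply]
    split_ifs <;> simp
  commutes' r := by
    ext ⟨x, q⟩ ⟨y, s⟩
    simp only [cqMatrix_apply, Pi.algebraMap_apply, Matrix.algebraMap_matrix_apply, Prod.mk.injEq]
    split_ifs <;> simp_all
  map_star' S := by
    ext ⟨x, q⟩ ⟨y, s⟩
    simp only [cqMatrix_apply, Matrix.star_apply, Pi.star_apply]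
    by_cases h : x = y
    · simp [h]
    · simp [h, Ne.symm h]

theorem cqHom_apply (S : X → Matrix Q Q ℂ) : cqHom X Q S = cqMatrix S := rfl

theorem cqHom_injective : Function.Injective (cqHom X Q) := fun S T h => by
  funext x
  ext q r
  simpa [cqHom_apply, cqMatrix_apply] using congrFun (congrFun h (x, q)) (x, r)

theorem trace_cqHom (S : X → Matrix Q Q ℂ) : (cqHom X Q S).trace = ∑ x, (S x).trace := by
  simp [cqHom_apply, Matrix.trace, cqMatrix_apply, Fintype.sum_prod_type]

/-- Diagonal matrices as a star algebra of block-diagonal matrices with one-dimensional blocks. -/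
def diagonalHom (X : Type*) [Fintype X] [DecidableEq X] :
    (X → Matrix Unit Unit ℂ) →⋆ₐ[ℝ] Matrix X X ℂ where
  toFun S := Matrix.diagonal fun x => S x () ()
  map_one' := by simp
  map_mul' S T := by simp [Matrix.mul_apply]
  map_zero' := by simp
  map_add' S T := by simp
  commutes' r := by
    ext x y
    simp [Matrix.algebraMap_matrix_apply, Matrix.diagonal_apply]
  map_star' S := by
    ext x y
    rw [Matrix.star_apply, Matrix.diagonal_apply, Matrix.diagonal_apply]
    by_cases h : x = y
    · simp [h]
    · simp [h, Ne.symm h]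

theorem diagonalHom_apply (S : X → Matrix Unit Unit ℂ) :
    diagonalHom X S = Matrix.diagonal fun x => S x () () := rfl

theorem diagonalHom_injective : Function.Injective (diagonalHom X) := fun S T h => by
  funext x
  ext ⟨⟩ ⟨⟩
  exact congrFun (Matrix.diagonal_injective h) x

theorem trace_diagonalHom (S : X → Matrix Unit Unit ℂ) :
    (diagonalHom X S).trace = ∑ x, (S x).trace := by
  simp [diagonalHom_apply, Matrix.trace]

/-- Every divergence of commuting (diagonal) operators is the classical one. -/
theorem eval_classicalState {τ p : X → ℝ} (hτ : ∀ x, 0 ≤ τ x) (hτ1 : ∑ x, τ x = 1)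
    (hp : ∀ x, 0 < p x) {𝔻 : Divergence} (h𝔻 : 𝔻.Admissible) :
    𝔻.eval (classicalState τ) (classicalState p) = ((𝔻.classical τ p : ℝ) : EReal) := by
  have hpos : ∀ f : X → ℝ, (∀ x, 0 ≤ f x) → ∀ x,
      (Matrix.diagonal fun _ : Unit => (f x : ℂ)).PosSemidef := fun f hf x =>
    .diagonal fun _ => by simpa using hf x
  -- One-dimensional blocks are always proportional, so the equality case of the general bound
  -- applies.
  have h := (eval_gap (diagonalHom X) diagonalHom_injective trace_diagonalHom
    (hpos τ hτ) (hpos p fun x => (hp x).le) (a := τ) (b := p) (by simp [Matrix.trace])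
    (by simp [Matrix.trace]) hp hτ1 h𝔻).2.2 fun x => by
      have := (hp x).ne'
      ext ⟨⟩ ⟨⟩
      rw [Matrix.smul_apply, Matrix.diagonal_apply_eq, Matrix.diagonal_apply_eq,
        Complex.real_smul, ← Complex.ofReal_mul, div_mul_cancel₀ _ this]
  simpa [diagonalHom_apply, classicalState] using h

omit [DecidableEq Q] in
theorem traceOutQ_cqMatrix (S : X → Matrix Q Q ℂ) :
    traceOutQ (cqMatrix S) = Matrix.diagonal fun x => (S x).trace := by
  ext x y
  by_cases h : x = y
  · simp [traceOutQ, cqMatrix_apply, Matrix.trace, h]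
  · simp [traceOutQ, cqMatrix_apply, h]

omit [Fintype X] [DecidableEq X] in
theorem posSemidef_sqrtSandwich (γ : Matrix Q Q ℂ) {M : X → Matrix Q Q ℂ}
    (hM : ∀ x, (M x).PosSemidef) (x : X) : (sqrtSandwich γ M x).PosSemidef := by
  have h := (hM x).mul_mul_conjTranspose_same (CFC.sqrt γ)
  rwa [(nonneg_iff_posSemidef.1 (CFC.sqrt_nonneg γ)).1.eq] at h

omit [Fintype X] [DecidableEq X] in
theorem trace_sqrtSandwich {γ : Matrix Q Q ℂ} (hγ : γ.PosSemidef) {M : X → Matrix Q Q ℂ}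
    (hM : ∀ x, (M x).PosSemidef) (x : X) :
    (sqrtSandwich γ M x).trace = (outcomeProb γ M x : ℂ) := by
  have h1 : (sqrtSandwich γ M x).trace = (γ * M x).trace := by
    rw [sqrtSandwich, Matrix.trace_mul_comm, ← Matrix.mul_assoc,
      CFC.sqrt_mul_sqrt_self γ (nonneg_iff_posSemidef.2 hγ)]
  rw [h1, outcomeProb]
  refine Complex.ext rfl ?_
  rw [Complex.ofReal_im, ← h1]
  exact (Complex.nonneg_iff.1 (posSemidef_sqrtSandwich γ hM x).trace_nonneg).2.symm

end States

end Retrodiction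

end

/-! ### The minimization theorem. -/

open Retrodiction in
theorem mainTheorem1 {X Q : Type*} [Fintype X] [DecidableEq X] [Fintype Q] [DecidableEq Q]
    (γ : Matrix Q Q ℂ) (hγ : Retrodiction.IsDensity γ)
    (M : X → Matrix Q Q ℂ) (hM : Retrodiction.IsPOVM M)
    (hp : ∀ x, 0 < Retrodiction.outcomeProb γ M x)
    (τ : X → ℝ) (hτ : ∀ x, 0 ≤ τ x) (hτ1 : ∑ x, τ x = 1) :
    Retrodiction.retrodictedState γ M τ ∈ Retrodiction.backwardStates X Q τ ∧
    ∀ 𝔻 : Retrodiction.Divergence, 𝔻.Admissible →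
      IsLeast ((fun S => 𝔻.eval S (Retrodiction.forwardState γ M)) ''
          Retrodiction.backwardStates X Q τ)
        (𝔻.eval (Retrodiction.classicalState τ)
          (Retrodiction.traceOutQ (Retrodiction.forwardState γ M))) ∧
      𝔻.eval (Retrodiction.classicalState τ)
          (Retrodiction.traceOutQ (Retrodiction.forwardState γ M)) =
        ((𝔻.classical τ (Retrodiction.outcomeProb γ M) : ℝ) : EReal) ∧
      ∀ S ∈ Retrodiction.backwardStates X Q τ,
        (IsMinOn (fun S' => 𝔻.eval S' (Retrodiction.forwardState γ M))
            (Retrodiction.backwardStates X Q τ) S ↔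
          S = Retrodiction.retrodictedState γ M τ) := by
  have hB := posSemidef_sqrtSandwich γ hM.1
  have hBtr := trace_sqrtSandwich hγ.1 hM.1
  have hBre : ∀ x, (sqrtSandwich γ M x).trace.re = outcomeProb γ M x := fun x => by
    rw [hBtr, Complex.ofReal_re]
  have hp0 : ∀ x, (outcomeProb γ M x : ℂ) ≠ 0 := fun x => Complex.ofReal_ne_zero.2 (hp x).ne'
  have hmem : retrodictedState γ M τ ∈ backwardStates X Q τ := by
    have hdens : ∀ x, IsDensity (bayesInverse γ M x) := fun x => by
      refine ⟨(hB x).smul (inv_nonneg.2 (Complex.zero_le_real.2 (hp x).le)), ?_⟩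
      rw [bayesInverse, Matrix.trace_smul, hBtr, smul_eq_mul, inv_mul_cancel₀ (hp0 x)]
    refine ⟨?_, bayesInverse γ M, hdens, rfl⟩
    rw [retrodictedState, traceOutQ_cqMatrix, classicalState]
    simp only [Matrix.trace_smul, (hdens _).2, smul_eq_mul, mul_one]
  have hmarginal : traceOutQ (forwardState γ M) = classicalState (outcomeProb γ M) := by
    rw [forwardState, traceOutQ_cqMatrix, classicalState]
    simp only [hBtr]
  refine ⟨hmem, fun 𝔻 h𝔻 => ?_⟩
  have hclassical := eval_classicalState hτ hτ1 hp h𝔻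
  have hmain : ∀ S ∈ backwardStates X Q τ,
      ((𝔻.classical τ (outcomeProb γ M) : ℝ) : EReal) ≤ 𝔻.eval S (forwardState γ M) ∧
        (𝔻.eval S (forwardState γ M) = ((𝔻.classical τ (outcomeProb γ M) : ℝ) : EReal) ↔
          S = retrodictedState γ M τ) := by
    rintro S ⟨-, σ, hσ, rfl⟩
    have h := eval_gap (cqHom X Q) cqHom_injective trace_cqHom
      (A := fun x => (τ x : ℂ) • σ x) (B := sqrtSandwich γ M)
      (fun x => (hσ x).1.smul (Complex.zero_le_real.2 (hτ x))) hB (a := τ)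
      (fun x => by simp [Matrix.trace_smul, (hσ x).2]) hBre hp hτ1 h𝔻
    refine ⟨h.1, h.2.trans ?_⟩
    rw [retrodictedState, ← cqHom_apply, ← cqHom_apply, cqHom_injective.eq_iff, funext_iff]
    refine forall_congr' fun x => ?_
    -- Blockwise proportionality with ratio `τ(x) / p(x)` is the defining formula of the retrodicted
    -- state.
    have hsmul : (τ x / outcomeProb γ M x) • sqrtSandwich γ M x =
        (τ x : ℂ) • bayesInverse γ M x := by
      rw [bayesInverse, smul_smul, ← Complex.coe_smul, Complex.ofReal_div, div_eq_mul_inv]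
    rw [hsmul]
  have hretro := (hmain _ hmem).2.2 rfl
  rw [hmarginal, hclassical]
  refine ⟨⟨⟨_, hmem, hretro⟩, ?_⟩, rfl, fun S hS => ⟨fun h => ?_, ?_⟩⟩
  · rintro _ ⟨S, hS, rfl⟩
    exact (hmain S hS).1
  · have h1 := isMinOn_iff.1 h _ hmem
    exact (hmain S hS).2.1 (le_antisymm (h1.trans_eq hretro) (hmain S hS).1)
  · rintro rfl
    exact isMinOn_iff.2 fun S' hS' => hretro.trans_le (hmain S' hS').1
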